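/- Let $\Bbbk$ be a field. Let $A$ be the (non-unital) zig-zag algebra over $\Bbbk$: the quotient of the path algebra of the quiver with vertex set $\mathbb Z$ and arrows $(r|r+1)\colon r\to r+1$ and $(r|r-1)\colon r\to r-1$, with product the concatenation of paths, by the relations $(r|r+1|r+2)=0$, $(r|r-1|r-2)=0$ and $(r|r-1|r)=(r|r+1|r)$, $r\in\mathbb Z$. It is graded by $\deg (r)=\deg (r|r+1)=0$ and $\deg (r|r-1)=1$, where $(r)$ denotes the idempotent at the vertex $r$. A graded $A$-module is a $\Bbbk$-vector space $M=\bigoplus_{j}M^j$ with an action of $A$, compatible with the gradings, such that $M=\bigoplus_{r}(r)M$; a path from $r$ to $s$ acts as a map $(r)M\to(s)M$, and a concatenation $xy$ acts as $x$ followed by $y$. Morphisms are the degree-preserving $A$-linear maps. Graded dg modules over $(A,d)$, with $A$ in homological degree $0$, are the same as cochain complexes $M=(M_k,d)_{k\in\mathbb Z}$ of graded $A$-modules. Let $\mathcal C(A\text{-pmod})$ be the homotopy category of (unbounded) complexes of graded projective $A$-modules, with its usual shift $[1]$, $(M[1])_k=M_{k+1}$ with differential $-d$, and its usual distinguished triangles.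 Let $\mathcal M_3$ be the category of tricomplexes, that is, of trigraded vector spaces $M=\bigoplus_{(i,j,k)\in\mathbb Z^3}M_{i,j,k}$ with maps $\partial_1,\partial_2,\partial_3$ of degrees $(1,0,0),(0,1,0),(0,0,1)$ such that $\partial_a^2=0$ and $\partial_a\partial_b+\partial_b\partial_a=0$ for $a\neq b$; equivalently, of trigraded modules over the exterior algebra $\Lambda_3$ on $\partial_1,\partial_2,\partial_3$. Its stable category $\mathcal{SM}_3$ has the same objects, and its morphisms are those of $\mathcal M_3$ modulo the morphisms which factor through a projective object. The shift $M[1]_{\mathcal{SM}}$ is the cokernel of the canonical embedding $\iota_M\colon M\to I(M):=\operatorname{Hom}_\Bbbk(\Lambda_3,M)\cong\Lambda_3\otimes M\{-1,-1,-1\}$, and the distinguished triangles are those isomorphic to $M\xrightarrow{f}N\to C\to M[1]_{\mathcal{SM}}$, where $f$ is a morphism of $\mathcal M_3$, $C$ is the pushout of $f$ and $\iota_M$, and $C\to M[1]_{\mathcal{SM}}$ is induced by $0$ on $N$ and by the projection on $I(M)$. For a complex $M$ of graded $A$-modules let $\mathcal G_\infty(M)\in\mathcal M_3$ be given by $\mathcal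 G_\infty(M)_{i,j,k}=(i-j)M_k^j$ with, writing $r=i-j$, $\partial_1$ the action of $(r|r+1)$, $\partial_2$ the action of $(r|r-1)$ multiplied by $(-1)^r$, and $\partial_3=(-1)^{r+k}d$. Then $\mathcal G_\infty$ is an equivalence from the category of graded dg modules over $(A,d)$ to $\mathcal M_3$, and it descends to an exact functor $$\mathcal G\colon \mathcal C(A\text{-pmod})\longrightarrow\mathcal{SM}_3 .$$ That is, there is an additive functor $\mathcal G$ whose composition with the projection from the category of complexes of graded projective $A$-modules to $\mathcal C(A\text{-pmod})$ equals the restriction of $\mathcal G_\infty$ followed by the projection $\mathcal M_3\to\mathcal{SM}_3$, together with a natural isomorphism $\mathcal G(M[1])\cong\mathcal G(M)[1]_{\mathcal{SM}}$ under which $\mathcal G$ takes distinguished triangles to distinguished triangles. -/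

import Mathlib

open CategoryTheory CategoryTheory.Limits

universe u

/-! ### The zig-zag algebra -/

/-- The paths of length at most one in the quiver with vertex set `ℤ` and arrows `r → r + 1` and
`r → r - 1`: `e r` is the trivial path `(r)`, `a r` is `(r|r+1)` and `b r` is `(r|r-1)`. -/
inductive ZigzagGen : Type
  | e (r : ℤ)
  | a (r : ℤ)
  | b (r : ℤ)

open ZigzagGen FreeAlgebra in
/-- The defining relations of the zig-zag algebra. Products of paths are concatenations:
`(i|j)·(j|k) = (i|j|k)`. -/
inductive ZigzagRel (𝕜 : Type u) [Field 𝕜] :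
    FreeAlgebra 𝕜 ZigzagGen → FreeAlgebra 𝕜 ZigzagGen → Prop
  | idem (r : ℤ) : ZigzagRel 𝕜 (ι 𝕜 (e r) * ι 𝕜 (e r)) (ι 𝕜 (e r))
  | orth (r s : ℤ) (h : r ≠ s) : ZigzagRel 𝕜 (ι 𝕜 (e r) * ι 𝕜 (e s)) 0
  | a_start (r : ℤ) : ZigzagRel 𝕜 (ι 𝕜 (e r) * ι 𝕜 (a r)) (ι 𝕜 (a r))
  | a_end (r : ℤ) : ZigzagRel 𝕜 (ι 𝕜 (a r) * ι 𝕜 (e (r + 1))) (ι 𝕜 (a r))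
  | b_start (r : ℤ) : ZigzagRel 𝕜 (ι 𝕜 (e r) * ι 𝕜 (b r)) (ι 𝕜 (b r))
  | b_end (r : ℤ) : ZigzagRel 𝕜 (ι 𝕜 (b r) * ι 𝕜 (e (r - 1))) (ι 𝕜 (b r))
  | a_a (r : ℤ) : ZigzagRel 𝕜 (ι 𝕜 (a r) * ι 𝕜 (a (r + 1))) 0
  | b_b (r : ℤ) : ZigzagRel 𝕜 (ι 𝕜 (b r) * ι 𝕜 (b (r - 1))) 0
  | loop (r : ℤ) : ZigzagRel 𝕜 (ι 𝕜 (b r) * ι 𝕜 (a (r - 1))) (ι 𝕜 (a r) * ι 𝕜 (b (r + 1)))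

/-- The zig-zag algebra `A = A_∞`, a non-unital algebra. It is the quotient of the path algebra of
the above quiver by the relations `(r|r+1|r+2) = 0`, `(r|r-1|r-2) = 0` and `(r|r-1|r) = (r|r+1|r)`,
realized as the non-unital subalgebra generated by the paths of length at most one inside its
unitization (the unital algebra with the same presentation). -/
def ZigzagAlg (𝕜 : Type u) [Field 𝕜] : NonUnitalSubalgebra 𝕜 (RingQuot (ZigzagRel 𝕜)) :=
  NonUnitalAlgebra.adjoin 𝕜
    (Set.range fun g => RingQuot.mkAlgHom 𝕜 (ZigzagRel 𝕜) (FreeAlgebra.ι 𝕜 g))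

namespace ZigzagAlg

variable (𝕜 : Type u) [Field 𝕜]

/-- The class in `A` of a path of length at most one. -/
def of (g : ZigzagGen) : ZigzagAlg 𝕜 :=
  ⟨RingQuot.mkAlgHom 𝕜 (ZigzagRel 𝕜) (FreeAlgebra.ι 𝕜 g),
    NonUnitalAlgebra.subset_adjoin 𝕜 ⟨g, rfl⟩⟩

/-- The idempotent `(r)`. -/
def e (r : ℤ) : ZigzagAlg 𝕜 := of 𝕜 (.e r)

/-- The path `(r|r+1)`. -/
def a (r : ℤ) : ZigzagAlg 𝕜 := of 𝕜 (.a r)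

/-- The path `(r|r-1)`. -/
def b (r : ℤ) : ZigzagAlg 𝕜 := of 𝕜 (.b r)

variable {𝕜}

theorem e_mul_e (r : ℤ) : e 𝕜 r * e 𝕜 r = e 𝕜 r :=
  Subtype.ext (((map_mul _ _ _).symm.trans (RingQuot.mkAlgHom_rel 𝕜 (.idem r))))

theorem a_mul_e (r : ℤ) : a 𝕜 r * e 𝕜 (r + 1) = a 𝕜 r :=
  Subtype.ext (((map_mul _ _ _).symm.trans (RingQuot.mkAlgHom_rel 𝕜 (.a_end r))))

theorem b_mul_e (r : ℤ) : b 𝕜 r * e 𝕜 (r - 1) = b 𝕜 r :=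
  Subtype.ext (((map_mul _ _ _).symm.trans (RingQuot.mkAlgHom_rel 𝕜 (.b_end r))))

theorem a_mul_a (r : ℤ) : a 𝕜 r * a 𝕜 (r + 1) = 0 :=
  Subtype.ext (((map_mul _ _ _).symm.trans
    ((RingQuot.mkAlgHom_rel 𝕜 (.a_a r)).trans (map_zero _))))

theorem b_mul_b (r : ℤ) : b 𝕜 r * b 𝕜 (r - 1) = 0 :=
  Subtype.ext (((map_mul _ _ _).symm.trans
    ((RingQuot.mkAlgHom_rel 𝕜 (.b_b r)).trans (map_zero _))))

theorem b_mul_a (r : ℤ) : b 𝕜 r * a 𝕜 (r - 1) = a 𝕜 r * b 𝕜 (r + 1) :=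
  Subtype.ext (((map_mul _ _ _).symm.trans
    ((RingQuot.mkAlgHom_rel 𝕜 (.loop r)).trans (map_mul _ _ _))))

/-- The grading of `A` determined by `deg (r) = deg (r|r+1) = 0` and `deg (r|r-1) = 1`:
`HasDegree x d` says that `x` is homogeneous of degree `d`. -/
inductive HasDegree : ZigzagAlg 𝕜 → ℤ → Prop
  | e (r : ℤ) : HasDegree (e 𝕜 r) 0
  | a (r : ℤ) : HasDegree (a 𝕜 r) 0
  | b (r : ℤ) : HasDegree (b 𝕜 r) 1
  | mul {x y : ZigzagAlg 𝕜} {d d' : ℤ} : HasDegree x d → HasDegree y d' → HasDegree (x * y) (d + d')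
  | zero (d : ℤ) : HasDegree 0 d
  | add {x y : ZigzagAlg 𝕜} {d : ℤ} : HasDegree x d → HasDegree y d → HasDegree (x + y) d
  | smul (c : 𝕜) {x : ZigzagAlg 𝕜} {d : ℤ} : HasDegree x d → HasDegree (c • x) d

end ZigzagAlg

/-! ### Graded modules over the zig-zag algebra -/

/-- A graded `A`-module: a `𝕜`-vector space with an action of the non-unital algebra `A` and a grading
`M = ⨁ⱼ Mʲ`, such that elements of degree `d` raise the degree by `d` and `M = ⨁ᵣ (r)M`. A product
`x * y` of paths acts as `x` followed by `y`, so that a path from the vertex `r` to the vertex `s`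
acts as a map `(r)M ⟶ (s)M`. -/
structure GrMod (𝕜 : Type u) [Field 𝕜] where
  carrier : Type u
  [grp : AddCommGroup carrier]
  [mod : Module 𝕜 carrier]
  act : ZigzagAlg 𝕜 →ₗ[𝕜] Module.End 𝕜 carrier
  act_mul : ∀ x y m, act (x * y) m = act y (act x m)
  gr : ℤ → Submodule 𝕜 carrier
  isInternal : DirectSum.IsInternal gr
  act_mem : ∀ {x : ZigzagAlg 𝕜} {d : ℤ}, ZigzagAlg.HasDegree x d →
    ∀ {j : ℤ} {m : carrier}, m ∈ gr j → act x m ∈ gr (j + d)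
  iSup_range : ⨆ r, LinearMap.range (act (ZigzagAlg.e 𝕜 r)) = ⊤

namespace GrMod

attribute [instance] GrMod.grp GrMod.mod

variable {𝕜 : Type u} [Field 𝕜]

/-- Morphisms of graded `A`-modules: `A`-linear maps which preserve the grading. -/
@[ext]
structure Hom (M N : GrMod 𝕜) where
  lin : M.carrier →ₗ[𝕜] N.carrier
  map_act : ∀ x m, lin (M.act x m) = N.act x (lin m)
  map_gr : ∀ {j m}, m ∈ M.gr j → lin m ∈ N.gr j

/-- The category of graded `A`-modules. -/
instance : Category (GrMod 𝕜) where
  Hom := Hom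
  id M := ⟨LinearMap.id, fun _ _ => rfl, id⟩
  comp f g := ⟨g.lin ∘ₗ f.lin, fun x m => by simp [f.map_act, g.map_act],
    fun h => g.map_gr (f.map_gr h)⟩

@[ext]
theorem hom_ext {M N : GrMod 𝕜} {f g : M ⟶ N} (h : ∀ x, f.lin x = g.lin x) : f = g :=
  Hom.ext (LinearMap.ext h)

@[simp] theorem id_lin (M : GrMod 𝕜) (x : M.carrier) : Hom.lin (𝟙 M) x = x := rfl

@[simp] theorem comp_lin {M N P : GrMod 𝕜} (f : M ⟶ N) (g : N ⟶ P) (x : M.carrier) :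
    (f ≫ g).lin x = g.lin (f.lin x) := rfl

instance (M N : GrMod 𝕜) : Zero (M ⟶ N) :=
  ⟨⟨0, fun _ _ => by simp, fun _ => by simp⟩⟩

instance (M N : GrMod 𝕜) : Add (M ⟶ N) :=
  ⟨fun f g => ⟨f.lin + g.lin, fun _ _ => by simp [f.map_act, g.map_act],
    fun h => add_mem (f.map_gr h) (g.map_gr h)⟩⟩

instance (M N : GrMod 𝕜) : Neg (M ⟶ N) :=
  ⟨fun f => ⟨-f.lin, fun _ _ => by simp [f.map_act], fun h => neg_mem (f.map_gr h)⟩⟩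

@[simp] theorem zero_lin {M N : GrMod 𝕜} (x : M.carrier) : (0 : M ⟶ N).lin x = 0 := rfl

@[simp] theorem add_lin {M N : GrMod 𝕜} (f g : M ⟶ N) (x : M.carrier) :
    (f + g).lin x = f.lin x + g.lin x := rfl

@[simp] theorem neg_lin {M N : GrMod 𝕜} (f : M ⟶ N) (x : M.carrier) :
    (-f).lin x = -f.lin x := rfl

instance (M N : GrMod 𝕜) : AddCommGroup (M ⟶ N) where
  add_assoc f g h := by ext; simp [add_assoc]
  zero_add f := by ext; simp
  add_zero f := by ext; simp
  add_comm f g := by ext; simp [add_comm]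
  neg_add_cancel f := by ext; simp
  nsmul := nsmulRec
  zsmul := zsmulRec

instance : Preadditive (GrMod 𝕜) where
  add_comp _ _ _ f g h := by ext; simp
  comp_add _ _ _ f g h := by ext; simp

/-- The zero module. -/
def zeroObj (𝕜 : Type u) [Field 𝕜] : GrMod 𝕜 where
  carrier := PUnit.{u + 1}
  act := 0
  act_mul _ _ _ := rfl
  gr _ := ⊤
  isInternal := (DirectSum.isInternal_submodule_iff_iSupIndep_and_iSup_eq_top _).2
    ⟨fun _ => Submodule.disjoint_def.2 fun _ _ _ => rfl, Subsingleton.elim _ _⟩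
  act_mem _ _ _ _ := trivial
  iSup_range := Subsingleton.elim _ _

theorem isZero_zeroObj : IsZero (zeroObj 𝕜) := by
  rw [IsZero.iff_id_eq_zero]
  ext x
  rfl

instance : HasZeroObject (GrMod 𝕜) := ⟨zeroObj 𝕜, isZero_zeroObj⟩

theorem iSup_prod_eq_top {V W : Type u} [AddCommGroup V] [Module 𝕜 V] [AddCommGroup W] [Module 𝕜 W]
    {p : ℤ → Submodule 𝕜 V} {q : ℤ → Submodule 𝕜 W} (hp : ⨆ i, p i = ⊤) (hq : ⨆ i, q i = ⊤) :
    ⨆ i, (p i).prod (q i) = ⊤ := by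
  rw [eq_top_iff, ← Submodule.prod_top, ← hp, ← hq, LinearMap.prod_eq_sup_map, Submodule.map_iSup,
    Submodule.map_iSup]
  refine sup_le (iSup_mono fun i => ?_) (iSup_mono fun i => ?_)
  · rintro _ ⟨x, hx, rfl⟩
    exact ⟨hx, zero_mem _⟩
  · rintro _ ⟨x, hx, rfl⟩
    exact ⟨zero_mem _, hx⟩

/-- The direct sum of two graded modules. -/
def prod (M N : GrMod 𝕜) : GrMod 𝕜 where
  carrier := M.carrier × N.carrier
  act :=
    { toFun := fun x => (M.act x).prodMap (N.act x)
      map_add' := fun x y => by ext <;> simp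
      map_smul' := fun c x => by ext <;> simp }
  act_mul x y m := by ext <;> simp [M.act_mul, N.act_mul]
  gr j := (M.gr j).prod (N.gr j)
  isInternal := by
    rw [DirectSum.isInternal_submodule_iff_iSupIndep_and_iSup_eq_top]
    have hM := (DirectSum.isInternal_submodule_iff_iSupIndep_and_iSup_eq_top _).1 M.isInternal
    have hN := (DirectSum.isInternal_submodule_iff_iSupIndep_and_iSup_eq_top _).1 N.isInternal
    constructor
    · intro j
      rw [Submodule.disjoint_def]
      intro x hx hx'
      have h1 : ⨆ i, ⨆ (_ : i ≠ j), (M.gr i).prod (N.gr i) ≤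
          (⨆ i, ⨆ (_ : i ≠ j), M.gr i).prod (⨆ i, ⨆ (_ : i ≠ j), N.gr i) :=
        iSup₂_le fun i hi => Submodule.prod_mono
          (le_iSup₂_of_le (f := fun i (_ : i ≠ j) => M.gr i) i hi le_rfl)
          (le_iSup₂_of_le (f := fun i (_ : i ≠ j) => N.gr i) i hi le_rfl)
      have h2 := h1 hx'
      exact Prod.ext ((Submodule.disjoint_def.1 (hM.1 j)) _ hx.1 h2.1)
        ((Submodule.disjoint_def.1 (hN.1 j)) _ hx.2 h2.2)
    · exact iSup_prod_eq_top hM.2 hN.2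
  act_mem h _ _ hm := ⟨M.act_mem h hm.1, N.act_mem h hm.2⟩
  iSup_range := by
    refine Eq.trans (iSup_congr fun r => ?_) (iSup_prod_eq_top M.iSup_range N.iSup_range)
    ext ⟨m, n⟩
    constructor
    · rintro ⟨⟨x, y⟩, h⟩
      exact ⟨⟨x, congrArg Prod.fst h⟩, ⟨y, congrArg Prod.snd h⟩⟩
    · rintro ⟨⟨x, hx⟩, ⟨y, hy⟩⟩
      exact ⟨(x, y), Prod.ext hx hy⟩

instance : HasBinaryBiproducts (GrMod 𝕜) where
  has_binary_biproduct M N := HasBinaryBiproduct.mk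
    { bicone :=
        { pt := prod M N
          fst := ⟨LinearMap.fst _ _ _, fun _ _ => rfl, fun h => h.1⟩
          snd := ⟨LinearMap.snd _ _ _, fun _ _ => rfl, fun h => h.2⟩
          inl := ⟨LinearMap.inl _ _ _, fun _ _ => Prod.ext rfl (map_zero (N.act _)).symm,
            fun h => ⟨h, zero_mem _⟩⟩
          inr := ⟨LinearMap.inr _ _ _, fun _ _ => Prod.ext (map_zero (M.act _)).symm rfl,
            fun h => ⟨zero_mem _, h⟩⟩
          inl_fst := rfl
          inl_snd := rfl
          inr_fst := rfl
          inr_snd := rfl }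
      isBilimit := isBinaryBilimitOfTotal _ (by
        ext x
        exact Prod.ext (add_zero _) (zero_add _)) }

variable (𝕜)

/-- The category `A-pmod` of graded projective `A`-modules. -/
abbrev Proj : Type (u + 1) := (isProjective (GrMod 𝕜)).FullSubcategory

instance : (isProjective (GrMod 𝕜)).ContainsZero :=
  ⟨zeroObj 𝕜, isZero_zeroObj, isZero_zeroObj.projective⟩

instance : HasBinaryBiproducts (Proj 𝕜) where
  has_binary_biproduct M N := by
    have := M.property
    have := N.property
    have h : Projective (M.obj ⊞ N.obj) :=
      ⟨fun {E X} f e _ => ⟨biprod.desc (Projective.factorThru (biprod.inl ≫ f) e)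
        (Projective.factorThru (biprod.inr ≫ f) e), by
          apply biprod.hom_ext' <;> simp⟩⟩
    exact HasBinaryBiproduct.mk
      { bicone :=
          { pt := ⟨M.obj ⊞ N.obj, h⟩
            fst := ⟨biprod.fst⟩
            snd := ⟨biprod.snd⟩
            inl := ⟨biprod.inl⟩
            inr := ⟨biprod.inr⟩
            inl_fst := by ext1; exact biprod.inl_fst
            inl_snd := by ext1; exact biprod.inl_snd
            inr_fst := by ext1; exact biprod.inr_fst
            inr_snd := by ext1; exact biprod.inr_snd }
        isBilimit := isBinaryBilimitOfTotal _ (by ext1; exact biprod.total) }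


end GrMod

/-! ### Trigraded modules over the exterior algebra on three generators -/

/-- A trigraded module over the exterior algebra `Λ₃` over `𝕜` on `∂₁, ∂₂, ∂₃` of degrees
`(1,0,0)`, `(0,1,0)`, `(0,0,1)`: vector spaces `X i j k`, `i j k : ℤ`, and linear maps
`∂ᵣ` of degree `eᵣ` subject to `∂ᵣ² = 0` and `∂ᵣ ∂ₛ + ∂ₛ ∂ᵣ = 0`. The target
degree of each `∂ᵣ` is allowed to be any integer that is provably the right one. -/
structure TriMod (𝕜 : Type u) [Field 𝕜] where
  X : ℤ → ℤ → ℤ → Type u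
  [grp : ∀ i j k, AddCommGroup (X i j k)]
  [mod : ∀ i j k, Module 𝕜 (X i j k)]
  d1 : ∀ {i i' : ℤ} (j k : ℤ), i + 1 = i' → X i j k →ₗ[𝕜] X i' j k
  d2 : ∀ (i : ℤ) {j j' : ℤ} (k : ℤ), j + 1 = j' → X i j k →ₗ[𝕜] X i j' k
  d3 : ∀ (i j : ℤ) {k k' : ℤ}, k + 1 = k' → X i j k →ₗ[𝕜] X i j k'
  d1_d1 : ∀ {i i' i'' : ℤ} (j k : ℤ) (h : i + 1 = i') (h' : i' + 1 = i'') (x : X i j k),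
    d1 j k h' (d1 j k h x) = 0
  d2_d2 : ∀ (i : ℤ) {j j' j'' : ℤ} (k : ℤ) (h : j + 1 = j') (h' : j' + 1 = j'') (x : X i j k),
    d2 i k h' (d2 i k h x) = 0
  d3_d3 : ∀ (i j : ℤ) {k k' k'' : ℤ} (h : k + 1 = k') (h' : k' + 1 = k'') (x : X i j k),
    d3 i j h' (d3 i j h x) = 0
  d1_d2 : ∀ {i i' j j' : ℤ} (k : ℤ) (h : i + 1 = i') (h' : j + 1 = j') (x : X i j k),
    d1 j' k h (d2 i k h' x) + d2 i' k h' (d1 j k h x) = 0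
  d1_d3 : ∀ {i i' : ℤ} (j : ℤ) {k k' : ℤ} (h : i + 1 = i') (h' : k + 1 = k') (x : X i j k),
    d1 j k' h (d3 i j h' x) + d3 i' j h' (d1 j k h x) = 0
  d2_d3 : ∀ (i : ℤ) {j j' k k' : ℤ} (h : j + 1 = j') (h' : k + 1 = k') (x : X i j k),
    d2 i k' h (d3 i j h' x) + d3 i j' h' (d2 i k h x) = 0

namespace TriMod

attribute [instance] TriMod.grp TriMod.mod

variable {𝕜 : Type u} [Field 𝕜]

/-- Morphisms of trigraded `Λ₃`-modules: degree-preserving linear maps commuting with all `∂ᵣ`. -/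
@[ext]
structure Hom (M N : TriMod 𝕜) where
  app : ∀ i j k, M.X i j k →ₗ[𝕜] N.X i j k
  comm1 : ∀ {i i' : ℤ} (j k : ℤ) (h : i + 1 = i') (x : M.X i j k),
    app i' j k (M.d1 j k h x) = N.d1 j k h (app i j k x)
  comm2 : ∀ (i : ℤ) {j j' : ℤ} (k : ℤ) (h : j + 1 = j') (x : M.X i j k),
    app i j' k (M.d2 i k h x) = N.d2 i k h (app i j k x)
  comm3 : ∀ (i j : ℤ) {k k' : ℤ} (h : k + 1 = k') (x : M.X i j k),
    app i j k' (M.d3 i j h x) = N.d3 i j h (app i j k x)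

/-- The category `𝓜₃` of trigraded `Λ₃`-modules. -/
instance : Category (TriMod 𝕜) where
  Hom := Hom
  id M := ⟨fun _ _ _ => LinearMap.id, fun _ _ _ _ => rfl, fun _ _ _ _ _ _ => rfl,
    fun _ _ _ _ _ _ => rfl⟩
  comp f g := ⟨fun i j k => g.app i j k ∘ₗ f.app i j k,
    fun j k h x => by simp [f.comm1, g.comm1],
    fun i _ _ k h x => by simp [f.comm2, g.comm2],
    fun i j _ _ h x => by simp [f.comm3, g.comm3]⟩

@[ext]
theorem hom_ext {M N : TriMod 𝕜} {f g : M ⟶ N}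
    (h : ∀ i j k x, f.app i j k x = g.app i j k x) : f = g :=
  Hom.ext (by funext i j k; exact LinearMap.ext (h i j k))

@[simp] theorem id_app (M : TriMod 𝕜) (i j k : ℤ) (x : M.X i j k) :
    Hom.app (𝟙 M) i j k x = x := rfl

@[simp] theorem comp_app {M N P : TriMod 𝕜} (f : M ⟶ N) (g : N ⟶ P) (i j k : ℤ) (x : M.X i j k) :
    (f ≫ g).app i j k x = g.app i j k (f.app i j k x) := rfl

instance (M N : TriMod 𝕜) : Zero (M ⟶ N) :=
  ⟨⟨fun _ _ _ => 0, fun _ _ _ _ => by simp, fun _ _ _ _ _ _ => by simp,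
    fun _ _ _ _ _ _ => by simp⟩⟩

instance (M N : TriMod 𝕜) : Add (M ⟶ N) :=
  ⟨fun f g => ⟨fun i j k => f.app i j k + g.app i j k,
    fun _ _ _ _ => by simp [f.comm1, g.comm1], fun _ _ _ _ _ _ => by simp [f.comm2, g.comm2],
    fun _ _ _ _ _ _ => by simp [f.comm3, g.comm3]⟩⟩

instance (M N : TriMod 𝕜) : Neg (M ⟶ N) :=
  ⟨fun f => ⟨fun i j k => -f.app i j k,
    fun _ _ _ _ => by simp [f.comm1], fun _ _ _ _ _ _ => by simp [f.comm2],
    fun _ _ _ _ _ _ => by simp [f.comm3]⟩⟩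

@[simp] theorem zero_app {M N : TriMod 𝕜} (i j k : ℤ) (x : M.X i j k) :
    (0 : M ⟶ N).app i j k x = 0 := rfl

@[simp] theorem add_app {M N : TriMod 𝕜} (f g : M ⟶ N) (i j k : ℤ) (x : M.X i j k) :
    (f + g).app i j k x = f.app i j k x + g.app i j k x := rfl

@[simp] theorem neg_app {M N : TriMod 𝕜} (f : M ⟶ N) (i j k : ℤ) (x : M.X i j k) :
    (-f).app i j k x = -f.app i j k x := rfl

instance (M N : TriMod 𝕜) : AddCommGroup (M ⟶ N) where
  add_assoc f g h := by ext; simp [add_assoc]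
  zero_add f := by ext; simp
  add_zero f := by ext; simp
  add_comm f g := by ext; simp [add_comm]
  neg_add_cancel f := by ext; simp
  nsmul := nsmulRec
  zsmul := zsmulRec

@[simp] theorem sub_app {M N : TriMod 𝕜} (f g : M ⟶ N) (i j k : ℤ) (x : M.X i j k) :
    (f - g).app i j k x = f.app i j k x - g.app i j k x := by
  rw [sub_eq_add_neg, sub_eq_add_neg]; rfl

instance : Preadditive (TriMod 𝕜) where
  add_comp _ _ _ f g h := by ext; simp
  comp_add _ _ _ f g h := by ext; simp

/-- The cokernel of a morphism `f` of trigraded `Λ₃`-modules, computed degreewise. -/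
def coker {M N : TriMod 𝕜} (f : M ⟶ N) : TriMod 𝕜 where
  X i j k := N.X i j k ⧸ LinearMap.range (f.app i j k)
  d1 {i i'} j k h := Submodule.mapQ _ _ (N.d1 j k h) (by
    rintro _ ⟨x, rfl⟩; exact ⟨M.d1 j k h x, f.comm1 j k h x⟩)
  d2 i {j j'} k h := Submodule.mapQ _ _ (N.d2 i k h) (by
    rintro _ ⟨x, rfl⟩; exact ⟨M.d2 i k h x, f.comm2 i k h x⟩)
  d3 i j {k k'} h := Submodule.mapQ _ _ (N.d3 i j h) (by
    rintro _ ⟨x, rfl⟩; exact ⟨M.d3 i j h x, f.comm3 i j h x⟩)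
  d1_d1 j k h h' x := by
    induction x using Submodule.Quotient.induction_on with
    | _ x => simp [N.d1_d1]
  d2_d2 i _ _ _ k h h' x := by
    induction x using Submodule.Quotient.induction_on with
    | _ x => simp [N.d2_d2]
  d3_d3 i j _ _ _ h h' x := by
    induction x using Submodule.Quotient.induction_on with
    | _ x => simp [N.d3_d3]
  d1_d2 k h h' x := by
    induction x using Submodule.Quotient.induction_on with
    | _ x => simp [← Submodule.Quotient.mk_add, N.d1_d2]
  d1_d3 j _ _ h h' x := by
    induction x using Submodule.Quotient.induction_on with
    | _ x => simp [← Submodule.Quotient.mk_add, N.d1_d3]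
  d2_d3 i _ _ _ _ h h' x := by
    induction x using Submodule.Quotient.induction_on with
    | _ x => simp [← Submodule.Quotient.mk_add, N.d2_d3]

/-- The projection onto the cokernel. -/
def cokerπ {M N : TriMod 𝕜} (f : M ⟶ N) : N ⟶ coker f where
  app _ _ _ := Submodule.mkQ _
  comm1 _ _ _ _ := rfl
  comm2 _ _ _ _ _ _ := rfl
  comm3 _ _ _ _ _ _ := rfl

theorem comp_cokerπ {M N : TriMod 𝕜} (f : M ⟶ N) : f ≫ cokerπ f = 0 := by
  ext i j k x
  exact (Submodule.Quotient.mk_eq_zero _).2 ⟨x, rfl⟩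

/-- The universal property of the cokernel. -/
def cokerDesc {M N P : TriMod 𝕜} (f : M ⟶ N) (g : N ⟶ P) (hg : f ≫ g = 0) : coker f ⟶ P where
  app i j k := Submodule.liftQ _ (g.app i j k) (by
    rintro _ ⟨x, rfl⟩
    exact congrArg (fun t : M ⟶ P => t.app i j k x) hg)
  comm1 j k h x := by
    induction x using Submodule.Quotient.induction_on with
    | _ x => exact g.comm1 j k h x
  comm2 i _ _ k h x := by
    induction x using Submodule.Quotient.induction_on with
    | _ x => exact g.comm2 i k h x
  comm3 i j _ _ h x := by
    induction x using Submodule.Quotient.induction_on with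
    | _ x => exact g.comm3 i j h x

theorem cokerπ_desc {M N P : TriMod 𝕜} (f : M ⟶ N) (g : N ⟶ P) (hg : f ≫ g = 0) :
    cokerπ f ≫ cokerDesc f g hg = g := rfl

theorem epi_of_surjective {M N : TriMod 𝕜} (f : M ⟶ N)
    (hf : ∀ i j k, Function.Surjective (f.app i j k)) : Epi f where
  left_cancellation g h e := by
    ext i j k y
    obtain ⟨x, rfl⟩ := hf i j k y
    exact congrArg (fun t : M ⟶ _ => t.app i j k x) e

instance {M N : TriMod 𝕜} (f : M ⟶ N) : Epi (cokerπ f) :=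
  epi_of_surjective _ fun _ _ _ => Submodule.mkQ_surjective _

theorem surjective_of_epi {M N : TriMod 𝕜} (f : M ⟶ N) [Epi f] (i j k : ℤ) :
    Function.Surjective (f.app i j k) := by
  have h : cokerπ f = 0 := by
    rw [← cancel_epi f, comp_cokerπ, comp_zero]
  intro y
  exact (Submodule.Quotient.mk_eq_zero _).1 (congrArg (fun t : N ⟶ _ => t.app i j k y) h)

section Cofree

variable (V : ℤ → ℤ → ℤ → Type u) [∀ i j k, AddCommGroup (V i j k)] [∀ i j k, Module 𝕜 (V i j k)]

/-- The degree `(i,j,k)` part of `Hom_𝕜(Λ₃, V)`: an element `f` is recorded by its values at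
`1, ∂₁, ∂₂, ∂₃, ∂₁∂₂, ∂₁∂₃, ∂₂∂₃, ∂₁∂₂∂₃`, in this order. -/
@[ext]
structure CofreeX (V : ℤ → ℤ → ℤ → Type u) (i j k : ℤ) : Type u where
  e : V i j k
  a1 : V (i + 1) j k
  a2 : V i (j + 1) k
  a3 : V i j (k + 1)
  a12 : V (i + 1) (j + 1) k
  a13 : V (i + 1) j (k + 1)
  a23 : V i (j + 1) (k + 1)
  a123 : V (i + 1) (j + 1) (k + 1)

namespace CofreeX

variable {V} {i j k : ℤ}

instance : Zero (CofreeX V i j k) := ⟨⟨0, 0, 0, 0, 0, 0, 0, 0⟩⟩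

instance : Add (CofreeX V i j k) :=
  ⟨fun x y => ⟨x.e + y.e, x.a1 + y.a1, x.a2 + y.a2, x.a3 + y.a3,
    x.a12 + y.a12, x.a13 + y.a13, x.a23 + y.a23, x.a123 + y.a123⟩⟩

instance : Neg (CofreeX V i j k) :=
  ⟨fun x => ⟨-x.e, -x.a1, -x.a2, -x.a3, -x.a12, -x.a13, -x.a23, -x.a123⟩⟩

instance : SMul 𝕜 (CofreeX V i j k) :=
  ⟨fun c x => ⟨c • x.e, c • x.a1, c • x.a2, c • x.a3, c • x.a12,
    c • x.a13, c • x.a23, c • x.a123⟩⟩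

@[simp] theorem zero_e : (0 : CofreeX V i j k).e = 0 := rfl
@[simp] theorem add_e (x y : CofreeX V i j k) : (x + y).e = x.e + y.e := rfl
@[simp] theorem neg_e (x : CofreeX V i j k) : (-x).e = -x.e := rfl
@[simp] theorem smul_e (c : 𝕜) (x : CofreeX V i j k) : (c • x).e = c • x.e := rfl
@[simp] theorem zero_a1 : (0 : CofreeX V i j k).a1 = 0 := rfl
@[simp] theorem add_a1 (x y : CofreeX V i j k) : (x + y).a1 = x.a1 + y.a1 := rfl
@[simp] theorem neg_a1 (x : CofreeX V i j k) : (-x).a1 = -x.a1 := rfl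
@[simp] theorem smul_a1 (c : 𝕜) (x : CofreeX V i j k) : (c • x).a1 = c • x.a1 := rfl
@[simp] theorem zero_a2 : (0 : CofreeX V i j k).a2 = 0 := rfl
@[simp] theorem add_a2 (x y : CofreeX V i j k) : (x + y).a2 = x.a2 + y.a2 := rfl
@[simp] theorem neg_a2 (x : CofreeX V i j k) : (-x).a2 = -x.a2 := rfl
@[simp] theorem smul_a2 (c : 𝕜) (x : CofreeX V i j k) : (c • x).a2 = c • x.a2 := rfl
@[simp] theorem zero_a3 : (0 : CofreeX V i j k).a3 = 0 := rfl
@[simp] theorem add_a3 (x y : CofreeX V i j k) : (x + y).a3 = x.a3 + y.a3 := rfl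
@[simp] theorem neg_a3 (x : CofreeX V i j k) : (-x).a3 = -x.a3 := rfl
@[simp] theorem smul_a3 (c : 𝕜) (x : CofreeX V i j k) : (c • x).a3 = c • x.a3 := rfl
@[simp] theorem zero_a12 : (0 : CofreeX V i j k).a12 = 0 := rfl
@[simp] theorem add_a12 (x y : CofreeX V i j k) : (x + y).a12 = x.a12 + y.a12 := rfl
@[simp] theorem neg_a12 (x : CofreeX V i j k) : (-x).a12 = -x.a12 := rfl
@[simp] theorem smul_a12 (c : 𝕜) (x : CofreeX V i j k) : (c • x).a12 = c • x.a12 := rfl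
@[simp] theorem zero_a13 : (0 : CofreeX V i j k).a13 = 0 := rfl
@[simp] theorem add_a13 (x y : CofreeX V i j k) : (x + y).a13 = x.a13 + y.a13 := rfl
@[simp] theorem neg_a13 (x : CofreeX V i j k) : (-x).a13 = -x.a13 := rfl
@[simp] theorem smul_a13 (c : 𝕜) (x : CofreeX V i j k) : (c • x).a13 = c • x.a13 := rfl
@[simp] theorem zero_a23 : (0 : CofreeX V i j k).a23 = 0 := rfl
@[simp] theorem add_a23 (x y : CofreeX V i j k) : (x + y).a23 = x.a23 + y.a23 := rfl
@[simp] theorem neg_a23 (x : CofreeX V i j k) : (-x).a23 = -x.a23 := rfl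
@[simp] theorem smul_a23 (c : 𝕜) (x : CofreeX V i j k) : (c • x).a23 = c • x.a23 := rfl
@[simp] theorem zero_a123 : (0 : CofreeX V i j k).a123 = 0 := rfl
@[simp] theorem add_a123 (x y : CofreeX V i j k) : (x + y).a123 = x.a123 + y.a123 := rfl
@[simp] theorem neg_a123 (x : CofreeX V i j k) : (-x).a123 = -x.a123 := rfl
@[simp] theorem smul_a123 (c : 𝕜) (x : CofreeX V i j k) : (c • x).a123 = c • x.a123 := rfl

instance : AddCommGroup (CofreeX V i j k) where
  add_assoc x y z := by ext <;> simp [add_assoc]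
  zero_add x := by ext <;> simp
  add_zero x := by ext <;> simp
  add_comm x y := by ext <;> simp [add_comm]
  neg_add_cancel x := by ext <;> simp
  nsmul := nsmulRec
  zsmul := zsmulRec

instance : Module 𝕜 (CofreeX V i j k) where
  one_smul x := by ext <;> simp
  mul_smul c d x := by ext <;> simp [mul_smul]
  smul_zero c := by ext <;> simp
  smul_add c x y := by ext <;> simp
  add_smul c d x := by ext <;> simp [add_smul]
  zero_smul x := by ext <;> simp

end CofreeX

/-- The action of `∂₁` on `Hom_𝕜(Λ₃, V)`. -/
@[simps] def cofree1 (i j k : ℤ) : CofreeX V i j k →ₗ[𝕜] CofreeX V (i + 1) j k where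
  toFun x := ⟨x.a1, 0, -x.a12, -x.a13, 0, 0, x.a123, 0⟩
  map_add' x y := by ext <;> simp [add_comm]
  map_smul' c x := by ext <;> simp

/-- The action of `∂₂` on `Hom_𝕜(Λ₃, V)`. -/
@[simps] def cofree2 (i j k : ℤ) : CofreeX V i j k →ₗ[𝕜] CofreeX V i (j + 1) k where
  toFun x := ⟨x.a2, x.a12, 0, -x.a23, 0, -x.a123, 0, 0⟩
  map_add' x y := by ext <;> simp [add_comm]
  map_smul' c x := by ext <;> simp

/-- The action of `∂₃` on `Hom_𝕜(Λ₃, V)`. -/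
@[simps] def cofree3 (i j k : ℤ) : CofreeX V i j k →ₗ[𝕜] CofreeX V i j (k + 1) where
  toFun x := ⟨x.a3, x.a13, x.a23, 0, x.a123, 0, 0, 0⟩
  map_add' x y := by ext <;> simp
  map_smul' c x := by ext <;> simp

variable (𝕜) in
/-- The trigraded `Λ₃`-module `Hom_𝕜(Λ₃, V)` coinduced from a trigraded vector space `V`: `Λ₃` acts by
`(∂ f)(y) = f (y ∂)`. As `Λ₃` is a Frobenius algebra whose top degree is `(1,1,1)`, this is the
free module `Λ₃ ⊗ V {-1,-1,-1}`. -/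
def cofree : TriMod 𝕜 where
  X i j k := CofreeX V i j k
  d1 {i i'} j k h := h ▸ cofree1 V i j k
  d2 i {j j'} k h := h ▸ cofree2 V i j k
  d3 i j {k k'} h := h ▸ cofree3 V i j k
  d1_d1 j k h h' x := by subst h h'; ext <;> simp
  d2_d2 i _ _ _ k h h' x := by subst h h'; ext <;> simp
  d3_d3 i j _ _ _ h h' x := by subst h h'; ext <;> simp
  d1_d2 k h h' x := by subst h h'; ext <;> simp
  d1_d3 j _ _ h h' x := by subst h h'; ext <;> simp
  d2_d3 i _ _ _ _ h h' x := by subst h h'; ext <;> simp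

variable {V}

variable {W : ℤ → ℤ → ℤ → Type u} [∀ i j k, AddCommGroup (W i j k)] [∀ i j k, Module 𝕜 (W i j k)]

/-- The linear map underlying `cofreeMap`. -/
@[simps] def cofreeMapX (φ : ∀ i j k, V i j k →ₗ[𝕜] W i j k) (i j k : ℤ) :
    CofreeX V i j k →ₗ[𝕜] CofreeX W i j k where
  toFun x := ⟨φ _ _ _ x.e, φ _ _ _ x.a1, φ _ _ _ x.a2, φ _ _ _ x.a3, φ _ _ _ x.a12,
    φ _ _ _ x.a13, φ _ _ _ x.a23, φ _ _ _ x.a123⟩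
  map_add' x y := by ext <;> simp
  map_smul' c x := by ext <;> simp

theorem cofreeMapX_cofree1 (φ : ∀ i j k, V i j k →ₗ[𝕜] W i j k) (i j k : ℤ)
    (x : CofreeX V i j k) : cofreeMapX φ (i + 1) j k (cofree1 (𝕜 := 𝕜) V i j k x) =
      cofree1 (𝕜 := 𝕜) W i j k (cofreeMapX φ i j k x) := by
  ext <;> simp

theorem cofreeMapX_cofree2 (φ : ∀ i j k, V i j k →ₗ[𝕜] W i j k) (i j k : ℤ)
    (x : CofreeX V i j k) : cofreeMapX φ i (j + 1) k (cofree2 (𝕜 := 𝕜) V i j k x) =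
      cofree2 (𝕜 := 𝕜) W i j k (cofreeMapX φ i j k x) := by
  ext <;> simp

theorem cofreeMapX_cofree3 (φ : ∀ i j k, V i j k →ₗ[𝕜] W i j k) (i j k : ℤ)
    (x : CofreeX V i j k) : cofreeMapX φ i j (k + 1) (cofree3 (𝕜 := 𝕜) V i j k x) =
      cofree3 (𝕜 := 𝕜) W i j k (cofreeMapX φ i j k x) := by
  ext <;> simp

/-- Functoriality of `V ↦ Hom_𝕜(Λ₃, V)` in the trigraded vector space `V`. -/
def cofreeMap (φ : ∀ i j k, V i j k →ₗ[𝕜] W i j k) : cofree 𝕜 V ⟶ cofree 𝕜 W where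
  app := cofreeMapX φ
  comm1 {i _} j k h x := by
    subst h
    exact cofreeMapX_cofree1 φ i j k x
  comm2 i {j _} k h x := by
    subst h
    exact cofreeMapX_cofree2 φ i j k x
  comm3 i j {k _} h x := by
    subst h
    exact cofreeMapX_cofree3 φ i j k x

end Cofree

/-- The linear map underlying `toCofree`. -/
@[simps] def toCofreeX (M : TriMod 𝕜) (i j k : ℤ) : M.X i j k →ₗ[𝕜] CofreeX M.X i j k where
  toFun m := ⟨m, M.d1 j k rfl m, M.d2 i k rfl m, M.d3 i j rfl m,
    M.d1 (j + 1) k rfl (M.d2 i k rfl m), M.d1 j (k + 1) rfl (M.d3 i j rfl m),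
    M.d2 i (k + 1) rfl (M.d3 i j rfl m),
    M.d1 (j + 1) (k + 1) rfl (M.d2 i (k + 1) rfl (M.d3 i j rfl m))⟩
  map_add' x y := by ext <;> simp
  map_smul' c x := by ext <;> simp

/-- The canonical embedding `M ⟶ Hom_𝕜(Λ₃, M)`, `m ↦ (y ↦ y m)`. -/
def toCofree (M : TriMod 𝕜) : M ⟶ cofree 𝕜 M.X where
  app := toCofreeX M
  comm1 {i _} j k h x := by
    subst h
    have h12 := eq_neg_of_add_eq_zero_right (M.d1_d2 k (rfl : i + 1 = _) (rfl : j + 1 = _) x)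
    have h13 := eq_neg_of_add_eq_zero_right (M.d1_d3 j (rfl : i + 1 = _) (rfl : k + 1 = _) x)
    have h23 := eq_neg_of_add_eq_zero_right
      (M.d1_d2 (k + 1) (rfl : i + 1 = _) (rfl : j + 1 = _) (M.d3 i j rfl x))
    change toCofreeX M _ _ _ (M.d1 j k rfl x) = cofree1 (𝕜 := 𝕜) M.X i j k (toCofreeX M _ _ _ x)
    ext <;> simp [h12, h13, h23, M.d1_d1]
  comm2 i {j _} k h x := by
    subst h
    have h23 := eq_neg_of_add_eq_zero_right (M.d2_d3 i (rfl : j + 1 = _) (rfl : k + 1 = _) x)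
    change toCofreeX M _ _ _ (M.d2 i k rfl x) = cofree2 (𝕜 := 𝕜) M.X i j k (toCofreeX M _ _ _ x)
    ext <;> simp [h23, M.d2_d2]
  comm3 i j {k _} h x := by
    subst h
    change toCofreeX M _ _ _ (M.d3 i j rfl x) = cofree3 (𝕜 := 𝕜) M.X i j k (toCofreeX M _ _ _ x)
    ext <;> simp [M.d3_d3]

theorem toCofree_naturality {M N : TriMod 𝕜} (f : M ⟶ N) :
    f ≫ toCofree N = toCofree M ≫ cofreeMap f.app := by
  ext i j k x
  change toCofreeX N _ _ _ (f.app i j k x) = cofreeMapX f.app _ _ _ (toCofreeX M _ _ _ x)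
  ext <;> simp [f.comm1, f.comm2, f.comm3]

theorem cofreeMap_id (M : TriMod 𝕜) : cofreeMap (Hom.app (𝟙 M)) = 𝟙 (cofree 𝕜 M.X) := rfl

theorem cofreeMap_comp {M N P : TriMod 𝕜} (f : M ⟶ N) (g : N ⟶ P) :
    cofreeMap (f ≫ g).app = cofreeMap f.app ≫ cofreeMap g.app := rfl

/-! ### The suspension -/

/-- The suspension of `M`: the cokernel of the embedding of `M` into `Hom_𝕜(Λ₃, M)`. -/
def susp (M : TriMod 𝕜) : TriMod 𝕜 := coker (toCofree M)

/-- The projection `Hom_𝕜(Λ₃, M) ⟶ susp M`. -/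
def toSusp (M : TriMod 𝕜) : cofree 𝕜 M.X ⟶ susp M := cokerπ (toCofree M)

instance (M : TriMod 𝕜) : Epi (toSusp M) := inferInstanceAs (Epi (cokerπ _))

theorem toCofree_toSusp (M : TriMod 𝕜) : toCofree M ≫ toSusp M = 0 := comp_cokerπ _

/-- The suspension of a morphism. -/
def suspMap {M N : TriMod 𝕜} (f : M ⟶ N) : susp M ⟶ susp N :=
  cokerDesc (toCofree M) (cofreeMap f.app ≫ toSusp N) (by
    rw [← Category.assoc, ← toCofree_naturality, Category.assoc, toCofree_toSusp, comp_zero])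

theorem toSusp_suspMap {M N : TriMod 𝕜} (f : M ⟶ N) :
    toSusp M ≫ suspMap f = cofreeMap f.app ≫ toSusp N := cokerπ_desc _ _ _

theorem toSusp_suspMap_assoc {M N P : TriMod 𝕜} (f : M ⟶ N) (g : susp N ⟶ P) :
    toSusp M ≫ suspMap f ≫ g = cofreeMap f.app ≫ toSusp N ≫ g := rfl

/-- The suspension functor on trigraded `Λ₃`-modules. -/
def suspFunctor : TriMod 𝕜 ⥤ TriMod 𝕜 where
  obj := susp
  map := suspMap
  map_id M := by
    rw [← cancel_epi (toSusp M), toSusp_suspMap, cofreeMap_id, Category.id_comp, Category.comp_id]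
  map_comp {M N P} f g := by
    rw [← cancel_epi (toSusp M), toSusp_suspMap, cofreeMap_comp, Category.assoc,
      ← toSusp_suspMap, toSusp_suspMap_assoc]

theorem suspMap_add {M N : TriMod 𝕜} (f g : M ⟶ N) : suspMap (f + g) = suspMap f + suspMap g := by
  rw [← cancel_epi (toSusp M), Preadditive.comp_add, toSusp_suspMap, toSusp_suspMap,
    toSusp_suspMap, ← Preadditive.add_comp]
  rfl

instance : (suspFunctor (𝕜 := 𝕜)).Additive where
  map_add := suspMap_add _ _

/-! ### Coinduced modules are projective -/

section

variable {V : ℤ → ℤ → ℤ → Type u} [∀ i j k, AddCommGroup (V i j k)] [∀ i j k, Module 𝕜 (V i j k)]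

variable (𝕜 V) in
/-- Families of linear maps `V ⟶ N` of degree `(-1,-1,-1)`. -/
abbrev TopMap (N : TriMod 𝕜) := ∀ ⦃i i' j j' k k' : ℤ⦄, i + 1 = i' → j + 1 = j' → k + 1 = k' →
  (V i' j' k' →ₗ[𝕜] N.X i j k)

/-- The formula for the morphism `cofree 𝕜 V ⟶ N` with a given restriction to the generators. -/
def fromAux (N : TriMod 𝕜) (l : TopMap 𝕜 V N) {i j k p q r : ℤ} (hp : p + 1 = i) (hq : q + 1 = j)
    (hr : r + 1 = k) (x : CofreeX V i j k) : N.X i j k :=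
  l rfl rfl rfl x.a123 + N.d1 j k hp (l hp rfl rfl x.a23) - N.d2 i k hq (l rfl hq rfl x.a13) +
    N.d3 i j hr (l rfl rfl hr x.a12) + N.d1 j k hp (N.d2 p k hq (l hp hq rfl x.a3)) -
    N.d1 j k hp (N.d3 p j hr (l hp rfl hr x.a2)) + N.d2 i k hq (N.d3 i q hr (l rfl hq hr x.a1)) +
    N.d1 j k hp (N.d2 p k hq (N.d3 p q hr (l hp hq hr x.e)))

/-- The linear map underlying `fromCofree`. -/
def fromCofreeX (N : TriMod 𝕜) (l : TopMap 𝕜 V N) (i j k : ℤ) :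
    CofreeX V i j k →ₗ[𝕜] N.X i j k where
  toFun := fromAux N l (sub_add_cancel i 1) (sub_add_cancel j 1) (sub_add_cancel k 1)
  map_add' x y := by simp only [fromAux, CofreeX.add_e, CofreeX.add_a1, CofreeX.add_a2,
    CofreeX.add_a3, CofreeX.add_a12, CofreeX.add_a13, CofreeX.add_a23, CofreeX.add_a123, map_add]
                     abel
  map_smul' c x := by simp [fromAux, smul_add, smul_sub]

theorem fromCofreeX_eq (N : TriMod 𝕜) (l : TopMap 𝕜 V N) {i j k p q r : ℤ} (hp : p + 1 = i)
    (hq : q + 1 = j) (hr : r + 1 = k) (x : CofreeX V i j k) :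
    fromCofreeX N l i j k x = fromAux N l hp hq hr x := by
  obtain rfl : p = i - 1 := by omega
  obtain rfl : q = j - 1 := by omega
  obtain rfl : r = k - 1 := by omega
  rfl

/-- The morphism `cofree 𝕜 V ⟶ N` with a given restriction to the generators. -/
def fromCofree (N : TriMod 𝕜) (l : TopMap 𝕜 V N) : cofree 𝕜 V ⟶ N where
  app := fromCofreeX N l
  comm1 {i i'} j k h := by
    subst h
    intro (x : CofreeX V i j k)
    obtain ⟨i, rfl⟩ : ∃ p, p + 1 = i := ⟨i - 1, by simp⟩
    obtain ⟨j, rfl⟩ : ∃ p, p + 1 = j := ⟨j - 1, by simp⟩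
    obtain ⟨k, rfl⟩ : ∃ p, p + 1 = k := ⟨k - 1, by simp⟩
    change fromCofreeX N l _ _ _ (cofree1 (𝕜 := 𝕜) V _ _ _ x) = N.d1 _ _ rfl (fromCofreeX N l _ _ _ x)
    rw [fromCofreeX_eq N l rfl rfl rfl, fromCofreeX_eq N l rfl rfl rfl]
    simp [fromAux, N.d1_d1]
    abel
  comm2 i {j j'} k h := by
    subst h
    intro (x : CofreeX V i j k)
    obtain ⟨i, rfl⟩ : ∃ p, p + 1 = i := ⟨i - 1, by simp⟩
    obtain ⟨j, rfl⟩ : ∃ p, p + 1 = j := ⟨j - 1, by simp⟩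
    obtain ⟨k, rfl⟩ : ∃ p, p + 1 = k := ⟨k - 1, by simp⟩
    change fromCofreeX N l _ _ _ (cofree2 (𝕜 := 𝕜) V _ _ _ x) = N.d2 _ _ rfl (fromCofreeX N l _ _ _ x)
    rw [fromCofreeX_eq N l rfl rfl rfl, fromCofreeX_eq N l rfl rfl rfl]
    have h12 := fun y => eq_neg_of_add_eq_zero_right
      (N.d1_d2 (i := i) (j := j + 1) (k + 1) rfl rfl y)
    simp [fromAux, N.d2_d2, h12]
  comm3 i j {k k'} h := by
    subst h
    intro (x : CofreeX V i j k)
    obtain ⟨i, rfl⟩ : ∃ p, p + 1 = i := ⟨i - 1, by simp⟩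
    obtain ⟨j, rfl⟩ : ∃ p, p + 1 = j := ⟨j - 1, by simp⟩
    obtain ⟨k, rfl⟩ : ∃ p, p + 1 = k := ⟨k - 1, by simp⟩
    change fromCofreeX N l _ _ _ (cofree3 (𝕜 := 𝕜) V _ _ _ x) = N.d3 _ _ rfl (fromCofreeX N l _ _ _ x)
    rw [fromCofreeX_eq N l rfl rfl rfl, fromCofreeX_eq N l rfl rfl rfl]
    have h13 := fun y => eq_neg_of_add_eq_zero_right
      (N.d1_d3 (i := i) (k := k + 1) (j + 1) rfl rfl y)
    have h23 := fun i' y => eq_neg_of_add_eq_zero_right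
      (N.d2_d3 (j := j) (k := k + 1) i' rfl rfl y)
    simp [fromAux, N.d3_d3, h13, h23]
    abel

theorem fromCofree_comp {N P : TriMod 𝕜} (l : TopMap 𝕜 V N) (f : N ⟶ P) :
    fromCofree N l ≫ f = fromCofree P (fun i _ j _ k _ hi hj hk => f.app i j k ∘ₗ l hi hj hk) := by
  ext i j k x
  change f.app i j k (fromAux N l (sub_add_cancel i 1) (sub_add_cancel j 1) (sub_add_cancel k 1) x) =
    fromAux P (fun i _ j _ k _ hi hj hk => f.app i j k ∘ₗ l hi hj hk) (sub_add_cancel i 1)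
      (sub_add_cancel j 1) (sub_add_cancel k 1) x
  simp [fromAux, f.comm1, f.comm2, f.comm3]

variable (𝕜 V) in
/-- The inclusion of the generators. -/
def gens : TopMap 𝕜 V (cofree 𝕜 V) := fun i _ j _ k _ hi hj hk => by
  subst hi hj hk
  exact
    { toFun := fun v => (⟨0, 0, 0, 0, 0, 0, 0, v⟩ : CofreeX V i j k)
      map_add' := fun x y => by
        change (_ : CofreeX V i j k) = (_ : CofreeX V i j k) + (_ : CofreeX V i j k)
        ext <;> simp
      map_smul' := fun c x => by
        change (_ : CofreeX V i j k) = c • (_ : CofreeX V i j k)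
        ext <;> simp }

theorem fromCofree_gens : fromCofree _ (gens 𝕜 V) = 𝟙 (cofree 𝕜 V) := by
  ext i j k x
  obtain ⟨i, rfl⟩ : ∃ p, p + 1 = i := ⟨i - 1, by simp⟩
  obtain ⟨j, rfl⟩ : ∃ p, p + 1 = j := ⟨j - 1, by simp⟩
  obtain ⟨k, rfl⟩ : ∃ p, p + 1 = k := ⟨k - 1, by simp⟩
  refine (fromCofreeX_eq _ (gens 𝕜 V) rfl rfl rfl x).trans ?_
  have key : ∀ y : CofreeX V (i + 1) (j + 1) (k + 1),
      (⟨0, 0, 0, 0, 0, 0, 0, y.a123⟩ + cofree1 (𝕜 := 𝕜) V i (j + 1) (k + 1) ⟨0, 0, 0, 0, 0, 0, 0, y.a23⟩ -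
      cofree2 (𝕜 := 𝕜) V _ _ _ ⟨0, 0, 0, 0, 0, 0, 0, y.a13⟩ +
      cofree3 (𝕜 := 𝕜) V _ _ _ ⟨0, 0, 0, 0, 0, 0, 0, y.a12⟩ +
      cofree1 (𝕜 := 𝕜) V _ _ _ (cofree2 (𝕜 := 𝕜) V _ _ _ ⟨0, 0, 0, 0, 0, 0, 0, y.a3⟩) -
      cofree1 (𝕜 := 𝕜) V _ _ _ (cofree3 (𝕜 := 𝕜) V _ _ _ ⟨0, 0, 0, 0, 0, 0, 0, y.a2⟩) +
      cofree2 (𝕜 := 𝕜) V _ _ _ (cofree3 (𝕜 := 𝕜) V _ _ _ ⟨0, 0, 0, 0, 0, 0, 0, y.a1⟩) +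
      cofree1 (𝕜 := 𝕜) V _ _ _ (cofree2 (𝕜 := 𝕜) V _ _ _
        (cofree3 (𝕜 := 𝕜) V _ _ _ ⟨0, 0, 0, 0, 0, 0, 0, y.e⟩)) : CofreeX V (i + 1) (j + 1) (k + 1)) = y := by
    intro y
    ext <;> simp [sub_eq_add_neg]
  exact key x

instance cofree_projective : Projective (cofree 𝕜 V) where
  factors {E X} f e _ := by
    choose s hs using fun i j k => LinearMap.exists_rightInverse_of_surjective (e.app i j k)
      (LinearMap.range_eq_top.2 (surjective_of_epi e i j k))
    have hf : fromCofree X (fun i _ j _ k _ hi hj hk => f.app i j k ∘ₗ gens 𝕜 V hi hj hk) = f := by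
      rw [← fromCofree_comp, fromCofree_gens, Category.id_comp]
    refine ⟨fromCofree E fun i _ j _ k _ hi hj hk =>
      s i j k ∘ₗ f.app i j k ∘ₗ gens 𝕜 V hi hj hk, ?_⟩
    rw [fromCofree_comp]
    refine Eq.trans ?_ hf
    congr 1
    funext i _ j _ k _ hi hj hk
    ext v
    exact congrArg (fun t => t (f.app i j k (gens 𝕜 V hi hj hk v))) (hs i j k)

end

/-- The identification of the degree `(i'-1, j'-1, k'-1)` part with the degree `(i,j,k)` part. -/
def unshift (P : TriMod 𝕜) :
    TopMap 𝕜 (fun i j k => P.X (i - 1) (j - 1) (k - 1)) P := fun i i' j j' k k' hi hj hk => by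
  obtain rfl : i = i' - 1 := by omega
  obtain rfl : j = j' - 1 := by omega
  obtain rfl : k = k' - 1 := by omega
  exact LinearMap.id

theorem unshift_surjective (P : TriMod 𝕜) {i i' j j' k k' : ℤ} (hi : i + 1 = i') (hj : j + 1 = j')
    (hk : k + 1 = k') : Function.Surjective (unshift P hi hj hk) := by
  obtain rfl : i = i' - 1 := by omega
  obtain rfl : j = j' - 1 := by omega
  obtain rfl : k = k' - 1 := by omega
  exact Function.surjective_id

/-- Every `P` is the target of an epimorphism from a coinduced module. -/
theorem epi_fromCofree_unshift (P : TriMod 𝕜) : Epi (fromCofree P (unshift P)) :=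
  epi_of_surjective _ fun i j k y => by
    obtain ⟨v, rfl⟩ := unshift_surjective P (rfl : i + 1 = _) (rfl : j + 1 = _) (rfl : k + 1 = _) y
    refine ⟨(⟨0, 0, 0, 0, 0, 0, 0, v⟩ :
      CofreeX (fun i j k => P.X (i - 1) (j - 1) (k - 1)) i j k), ?_⟩
    change fromAux P _ _ _ _ _ = _
    simp [fromAux]

/-- The embedding of a coinduced module into its coinduced module is split. -/
theorem toCofree_cofree_split (V : ℤ → ℤ → ℤ → Type u) [∀ i j k, AddCommGroup (V i j k)]
    [∀ i j k, Module 𝕜 (V i j k)] :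
    ∃ r, toCofree (cofree 𝕜 V) ≫ r = 𝟙 (cofree 𝕜 V) := by
  refine ⟨cofreeMap (V := (cofree 𝕜 V).X) fun i j k =>
    { toFun := fun x => CofreeX.e x, map_add' := fun _ _ => rfl, map_smul' := fun _ _ => rfl }, ?_⟩
  ext i j k x
  rfl

theorem susp_cofree_projective (V : ℤ → ℤ → ℤ → Type u) [∀ i j k, AddCommGroup (V i j k)]
    [∀ i j k, Module 𝕜 (V i j k)] : Projective (susp (cofree 𝕜 V)) := by
  obtain ⟨r, hr⟩ := toCofree_cofree_split (𝕜 := 𝕜) V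
  have h : toCofree (cofree 𝕜 V) ≫ (𝟙 _ - r ≫ toCofree (cofree 𝕜 V)) = 0 := by
    rw [Preadditive.comp_sub, ← Category.assoc, hr, Category.id_comp, Category.comp_id, sub_self]
  let s : susp (cofree 𝕜 V) ⟶ cofree 𝕜 (cofree 𝕜 V).X := cokerDesc _ _ h
  have hs : toSusp (cofree 𝕜 V) ≫ s = 𝟙 _ - r ≫ toCofree (cofree 𝕜 V) := cokerπ_desc _ _ h
  have hs' : s ≫ toSusp (cofree 𝕜 V) = 𝟙 (susp (cofree 𝕜 V)) := by
    rw [← cancel_epi (toSusp (cofree 𝕜 V)), ← Category.assoc, hs, Preadditive.sub_comp,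
      Category.assoc, toCofree_toSusp]
    simp
  exact (Retract.mk s (toSusp _) hs').projective

theorem susp_projective (P : TriMod 𝕜) [Projective P] : Projective (susp P) := by
  have := epi_fromCofree_unshift P
  have := susp_cofree_projective (𝕜 := 𝕜) (fun i j k => P.X (i - 1) (j - 1) (k - 1))
  have h : Retract P (cofree 𝕜 (fun i j k => P.X (i - 1) (j - 1) (k - 1))) :=
    ⟨Projective.factorThru (𝟙 P) (fromCofree P (unshift P)), _, Projective.factorThru_comp _ _⟩
  exact Retract.projective (Y := susp (cofree 𝕜 (fun i j k => P.X (i - 1) (j - 1) (k - 1))))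
    (h.map suspFunctor)

/-! ### The stable category -/

/-- Two morphisms are identified in the stable category if their difference factors through a
projective object. -/
def stableRel (𝕜 : Type u) [Field 𝕜] : HomRel (TriMod 𝕜) := fun M N f g =>
  ∃ (P : TriMod 𝕜) (_ : Projective P) (a : M ⟶ P) (b : P ⟶ N), f - g = a ≫ b

theorem stableRel_iff {M N : TriMod 𝕜} (f g : M ⟶ N) :
    stableRel 𝕜 f g ↔ ∃ a, f - g = a ≫ fromCofree N (unshift N) := by
  constructor
  · rintro ⟨P, _, a, b, h⟩
    have := epi_fromCofree_unshift N
    exact ⟨a ≫ Projective.factorThru b (fromCofree N (unshift N)), by simp [h]⟩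
  · rintro ⟨a, h⟩
    exact ⟨_, inferInstance, a, _, h⟩

instance : Congruence (stableRel 𝕜) where
  equivalence :=
    { refl := fun f => (stableRel_iff _ _).2 ⟨0, by simp⟩
      symm := fun {f g} h => by
        obtain ⟨a, h⟩ := (stableRel_iff _ _).1 h
        exact (stableRel_iff _ _).2 ⟨-a, by rw [Preadditive.neg_comp, ← h, neg_sub]⟩
      trans := fun {f g k} h h' => by
        obtain ⟨a, h⟩ := (stableRel_iff _ _).1 h
        obtain ⟨a', h'⟩ := (stableRel_iff _ _).1 h'
        exact (stableRel_iff _ _).2 ⟨a + a', by rw [Preadditive.add_comp, ← h, ← h']; abel⟩ }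
  comp_left f g g' := by
    rintro ⟨P, hP, a, b, h⟩
    exact ⟨P, hP, f ≫ a, b, by rw [← Preadditive.comp_sub, h, Category.assoc]⟩
  comp_right g := by
    rintro ⟨P, hP, a, b, h⟩
    exact ⟨P, hP, a, b ≫ g, by rw [← Preadditive.sub_comp, h, Category.assoc]⟩

theorem stableRel_add ⦃M N : TriMod 𝕜⦄ (f₁ f₂ g₁ g₂ : M ⟶ N) (h : stableRel 𝕜 f₁ f₂)
    (h' : stableRel 𝕜 g₁ g₂) : stableRel 𝕜 (f₁ + g₁) (f₂ + g₂) := by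
  obtain ⟨a, h⟩ := (stableRel_iff _ _).1 h
  obtain ⟨a', h'⟩ := (stableRel_iff _ _).1 h'
  exact (stableRel_iff _ _).2 ⟨a + a', by rw [Preadditive.add_comp, ← h, ← h']; abel⟩

end TriMod

/-- The stable category `𝓢𝓜₃` of trigraded `Λ₃`-modules: its objects are those of `𝓜₃` and its
morphisms are those of `𝓜₃` modulo the morphisms that factor through a projective object. -/
def StabMod (𝕜 : Type u) [Field 𝕜] : Type (u + 1) := CategoryTheory.Quotient (TriMod.stableRel 𝕜)

namespace StabMod

variable (𝕜 : Type u) [Field 𝕜]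

instance : Category (StabMod 𝕜) := inferInstanceAs (Category (CategoryTheory.Quotient _))

instance : Preadditive (StabMod 𝕜) :=
  CategoryTheory.Quotient.preadditive (TriMod.stableRel 𝕜) TriMod.stableRel_add

/-- The projection `𝓜₃ ⥤ 𝓢𝓜₃`. -/
def proj : TriMod 𝕜 ⥤ StabMod 𝕜 := CategoryTheory.Quotient.functor _

instance : (proj 𝕜).Additive where
  map_add := rfl

/-- The shift functor `[1]` of `𝓢𝓜₃`, induced by `TriMod.susp`. -/
def shift : StabMod 𝕜 ⥤ StabMod 𝕜 :=
  CategoryTheory.Quotient.lift _ (TriMod.suspFunctor ⋙ proj 𝕜) (by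
    rintro M N f g ⟨P, hP, a, b, h⟩
    have := TriMod.susp_projective P
    refine CategoryTheory.Quotient.sound _ ⟨_, this, TriMod.suspFunctor.map a,
      TriMod.suspFunctor.map b, ?_⟩
    rw [← Functor.map_sub, h, Functor.map_comp]
    rfl)

variable {𝕜} in
/-- A triangle `X ⟶ Y ⟶ Z ⟶ X[1]` of `𝓢𝓜₃` is distinguished if it is isomorphic to the
triangle `M ⟶ N ⟶ C ⟶ M[1]` of a morphism `f : M ⟶ N` of `𝓜₃`, where `C` is the cone of `f`,
that is, the pushout of `f` and of the embedding `M ⟶ Hom_𝕜(Λ₃, M)`, and `C ⟶ M[1]` is the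
morphism which is zero on `N` and the projection on `Hom_𝕜(Λ₃, M)`. -/
def IsDistinguished {X Y Z : StabMod 𝕜} (u : X ⟶ Y) (v : Y ⟶ Z) (w : Z ⟶ (shift 𝕜).obj X) :
    Prop :=
  ∃ (M N C : TriMod 𝕜) (f : M ⟶ N) (c : N ⟶ C) (e : TriMod.cofree 𝕜 M.X ⟶ C) (δ : C ⟶ M.susp)
    (α : X ≅ (proj 𝕜).obj M) (β : Y ≅ (proj 𝕜).obj N) (γ : Z ≅ (proj 𝕜).obj C),
    IsPushout f M.toCofree c e ∧ c ≫ δ = 0 ∧ e ≫ δ = M.toSusp ∧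
    u ≫ β.hom = α.hom ≫ (proj 𝕜).map f ∧ v ≫ γ.hom = β.hom ≫ (proj 𝕜).map c ∧
    w ≫ (shift 𝕜).map α.hom = γ.hom ≫ (proj 𝕜).map δ

end StabMod

/-! ### The functor `𝓖_∞` -/

namespace GrMod

variable {𝕜 : Type u} [Field 𝕜]

/-- The homogeneous part `(r)Mʲ` of a graded `A`-module `M`. -/
def part (M : GrMod 𝕜) (r j : ℤ) : Submodule 𝕜 M.carrier :=
  M.gr j ⊓ LinearMap.range (M.act (ZigzagAlg.e 𝕜 r))

theorem act_a_mem (M : GrMod 𝕜) {r s j : ℤ} (h : r + 1 = s) {m : M.carrier} (hm : m ∈ M.part r j) :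
    M.act (ZigzagAlg.a 𝕜 r) m ∈ M.part s j := by
  subst h
  refine ⟨by simpa using M.act_mem (.a r) hm.1, M.act (ZigzagAlg.a 𝕜 r) m, ?_⟩
  rw [← M.act_mul, ZigzagAlg.a_mul_e]

theorem act_b_mem (M : GrMod 𝕜) {r s j j' : ℤ} (h : r - 1 = s) (hj : j + 1 = j') {m : M.carrier}
    (hm : m ∈ M.part r j) : M.act (ZigzagAlg.b 𝕜 r) m ∈ M.part s j' := by
  subst h hj
  refine ⟨M.act_mem (.b r) hm.1, M.act (ZigzagAlg.b 𝕜 r) m, ?_⟩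
  rw [← M.act_mul, ZigzagAlg.b_mul_e]

theorem Hom.map_part {M N : GrMod 𝕜} (f : M ⟶ N) {r j : ℤ} {m : M.carrier} (hm : m ∈ M.part r j) :
    f.lin m ∈ N.part r j := by
  obtain ⟨h, x, rfl⟩ := hm
  exact ⟨f.map_gr h, f.lin x, (f.map_act _ _).symm⟩

end GrMod

namespace GInf

variable {𝕜 : Type u} [Field 𝕜] (M : CochainComplex (GrMod 𝕜) ℤ)

/-- `∂₁ = D₁` is the action of the arrow `(r|r+1)`, `r = i - j`. -/
def d1 {i i' : ℤ} (j k : ℤ) (h : i + 1 = i') :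
    (M.X k).part (i - j) j →ₗ[𝕜] (M.X k).part (i' - j) j :=
  ((M.X k).act (ZigzagAlg.a 𝕜 (i - j))).restrict fun _ hm => (M.X k).act_a_mem (by omega) hm

/-- `∂₂ = (-1)^r D₂`, where `D₂` is the action of the arrow `(r|r-1)`, `r = i - j`. -/
def d2 (i : ℤ) {j j' : ℤ} (k : ℤ) (h : j + 1 = j') :
    (M.X k).part (i - j) j →ₗ[𝕜] (M.X k).part (i - j') j' :=
  (i - j).negOnePow •
    ((M.X k).act (ZigzagAlg.b 𝕜 (i - j))).restrict fun _ hm => (M.X k).act_b_mem (by omega) h hm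

/-- `∂₃ = (-1)^(r+k) d`, `r = i - j`. -/
def d3 (i j : ℤ) {k k' : ℤ} (_ : k + 1 = k') :
    (M.X k).part (i - j) j →ₗ[𝕜] (M.X k').part (i - j) j :=
  (i - j + k).negOnePow • (M.d k k').lin.restrict fun _ hm => (M.d k k').map_part hm

theorem coe_d1 {i i' : ℤ} (j k : ℤ) (h : i + 1 = i') (x : (M.X k).part (i - j) j) :
    (d1 M j k h x : (M.X k).carrier) = (M.X k).act (ZigzagAlg.a 𝕜 (i - j)) x := rfl

theorem coe_d2 (i : ℤ) {j j' : ℤ} (k : ℤ) (h : j + 1 = j') (x : (M.X k).part (i - j) j) :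
    (d2 M i k h x : (M.X k).carrier) =
      (i - j).negOnePow • (M.X k).act (ZigzagAlg.b 𝕜 (i - j)) x := rfl

theorem coe_d3 (i j : ℤ) {k k' : ℤ} (h : k + 1 = k') (x : (M.X k).part (i - j) j) :
    (d3 M i j h x : (M.X k').carrier) = (i - j + k).negOnePow • (M.d k k').lin x := rfl

/-- The trigraded `Λ₃`-module attached to a complex `M` of graded `A`-modules: its degree
`(i,j,k)` part is `(i-j)M_k^j`. -/
def obj : TriMod 𝕜 where
  X i j k := (M.X k).part (i - j) j
  d1 := d1 M
  d2 := d2 M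
  d3 := d3 M
  d1_d1 {i i' i''} j k h h' x := by
    ext
    have : i' - j = i - j + 1 := by omega
    rw [coe_d1, coe_d1, this, ← (M.X k).act_mul, ZigzagAlg.a_mul_a]
    simp
  d2_d2 i {j j' j''} k h h' x := by
    ext
    have : i - j' = i - j - 1 := by omega
    rw [coe_d2, coe_d2, this, Units.smul_def, Units.smul_def, map_zsmul, ← (M.X k).act_mul, ZigzagAlg.b_mul_b]
    simp
  d3_d3 i j {k k' k''} h h' x := by
    ext
    have : (M.d k' k'').lin ((M.d k k').lin x) = 0 :=
      congrArg (fun f => GrMod.Hom.lin f (x : (M.X k).carrier)) (M.d_comp_d k k' k'')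
    rw [coe_d3, coe_d3, Units.smul_def, Units.smul_def, map_zsmul, this]
    simp
  d1_d2 {i i' j j'} k h h' x := by
    ext
    have e1 : i - j' = i - j - 1 := by omega
    have e2 : i' - j = i - j + 1 := by omega
    rw [Submodule.coe_add, coe_d1, coe_d2, coe_d2, coe_d1, e1, e2, Units.smul_def, Units.smul_def,
      map_zsmul, ← (M.X k).act_mul, ← (M.X k).act_mul, ZigzagAlg.b_mul_a, Int.negOnePow_succ]
    simp
  d1_d3 {i i'} j {k k'} h h' x := by
    ext
    have e1 : i' - j + k = i - j + k + 1 := by omega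
    rw [Submodule.coe_add, coe_d1, coe_d3, coe_d3, coe_d1, e1, Units.smul_def, Units.smul_def,
      map_zsmul, (M.d k k').map_act, Int.negOnePow_succ]
    simp
  d2_d3 i {j j' k k'} h h' x := by
    ext
    have e1 : i - j + k = i - j' + k + 1 := by omega
    rw [Submodule.coe_add, coe_d2, coe_d3, coe_d3, coe_d2, e1, Units.smul_def, Units.smul_def,
      Units.smul_def, Units.smul_def, map_zsmul, map_zsmul, (M.d k k').map_act, Int.negOnePow_succ,
      smul_comm]
    simp

variable {M} in
/-- The morphism of trigraded `Λ₃`-modules attached to a morphism of complexes. -/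
def map {N : CochainComplex (GrMod 𝕜) ℤ} (f : M ⟶ N) : obj M ⟶ obj N where
  app i j k := (f.f k).lin.restrict fun _ hm => (f.f k).map_part hm
  comm1 j k h x := Subtype.ext ((f.f k).map_act _ _)
  comm2 {i j j'} k h x := Subtype.ext (by
    refine (map_zsmul (f.f k).lin _ _).trans ?_
    exact congrArg _ ((f.f k).map_act _ _))
  comm3 i j {k k'} h x := Subtype.ext (by
    refine (map_zsmul (f.f k').lin _ _).trans ?_
    exact congrArg _ (congrArg (fun g => GrMod.Hom.lin g (Subtype.val x)) (f.comm k k')).symm)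

end GInf

/-- The functor `𝓖_∞` from complexes of graded `A`-modules (that is, graded dg modules over `(A,d)`,
with `A` in homological degree `0`) to trigraded `Λ₃`-modules. -/
def GInf (𝕜 : Type u) [Field 𝕜] : CochainComplex (GrMod 𝕜) ℤ ⥤ TriMod 𝕜 where
  obj := GInf.obj
  map := GInf.map

instance (𝕜 : Type u) [Field 𝕜] : (GInf 𝕜).Additive where

/-!
A trigraded `Λ₃`-module `T` is recovered as `𝓖_∞` of the complex which in degree `k` is the direct
sum of the `T_{i,j,k}`: the component `(i, j, k)` is the part of degree `j` at the vertex `i - j`,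
the signs `(-1)^r` turn the anticommutation of `∂₁`, `∂₂`, `∂₃` into the relations of the zig-zag
algebra and the `A`-linearity of `d`, and `A` acts by the universal property of its presentation.
Morphisms are recovered componentwise, so `𝓖_∞` is an equivalence.

A complex `M` of projectives embeds in the cone of its identity, with cokernel `M[1]`. Such a cone
is contractible and made of projectives, so `𝓖_∞` sends it to a projective object. Therefore null
homotopic maps, which factor through such a cone, vanish in `𝓢𝓜₃`, and `𝓖` exists. Moreover `𝓖_∞(M)`
gets a second embedding in a projective object besides the canonical one, and as `Λ₃` is a Frobenius
algebra, maps to projectives extend along both embeddings. By the dual of Schanuel's lemma their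
cokernels `𝓖_∞(M[1])` and `𝓖_∞(M)[1]` are then canonically isomorphic in `𝓢𝓜₃`, and so are the
pushouts of a morphism along the two, which are the image of the mapping cone and the cone in `𝓢𝓜₃`.
-/

section InternalDirectSum

variable {ι R V : Type*} [Ring R] [AddCommGroup V] [Module R V] {p : ι → Submodule R V}

theorem iSupIndep_of_projections (P : ι → V →ₗ[R] V) (h₁ : ∀ i, ∀ x ∈ p i, P i x = x)
    (h₂ : ∀ i j, j ≠ i → ∀ x ∈ p j, P i x = 0) : iSupIndep p := by
  intro i
  rw [Submodule.disjoint_def]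
  intro x hx hx'
  have h : ⨆ j, ⨆ (_ : j ≠ i), p j ≤ LinearMap.ker (P i) :=
    iSup₂_le fun j hj y hy => h₂ i j hj y hy
  rw [← h₁ i x hx]
  exact h hx'

theorem exists_linearMap_of_isInternal [DecidableEq ι] {W : Type*} [AddCommGroup W] [Module R W]
    (h : DirectSum.IsInternal p) (φ : ∀ i, p i →ₗ[R] W) :
    ∃ f : V →ₗ[R] W, ∀ i (x : p i), f x = φ i x := by
  let e := LinearEquiv.ofBijective (DirectSum.coeLinearMap p) h
  have he (i : ι) (x : p i) : e.symm x = DirectSum.lof R ι (fun i => p i) i x :=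
    (LinearEquiv.symm_apply_eq e).mpr (DirectSum.coeLinearMap_lof p i x).symm
  refine ⟨DirectSum.toModule R ι W φ ∘ₗ e.symm.toLinearMap, fun i x => ?_⟩
  rw [LinearMap.comp_apply, LinearEquiv.coe_coe, he, DirectSum.toModule_lof]

theorem exists_projection_of_isInternal [DecidableEq ι] (h : DirectSum.IsInternal p) (i : ι) :
    ∃ P : V →ₗ[R] V, (∀ x ∈ p i, P x = x) ∧ ∀ j, j ≠ i → ∀ x ∈ p j, P x = 0 := by
  obtain ⟨P, hP⟩ := exists_linearMap_of_isInternal h fun j => if j = i then (p j).subtype else 0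
  refine ⟨P, fun x hx => ?_, fun j hj x hx => ?_⟩
  · simpa using hP i ⟨x, hx⟩
  · simpa [hj] using hP j ⟨x, hx⟩

end InternalDirectSum

namespace ZigzagAlg

variable {𝕜 : Type u} [Field 𝕜]

theorem e_mul_e_of_ne {r s : ℤ} (h : r ≠ s) : e 𝕜 r * e 𝕜 s = 0 :=
  Subtype.ext ((map_mul _ _ _).symm.trans
    ((RingQuot.mkAlgHom_rel 𝕜 (.orth r s h)).trans (map_zero _)))

theorem e_mul_a (r : ℤ) : e 𝕜 r * a 𝕜 r = a 𝕜 r :=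
  Subtype.ext ((map_mul _ _ _).symm.trans (RingQuot.mkAlgHom_rel 𝕜 (.a_start r)))

theorem e_mul_b (r : ℤ) : e 𝕜 r * b 𝕜 r = b 𝕜 r :=
  Subtype.ext ((map_mul _ _ _).symm.trans (RingQuot.mkAlgHom_rel 𝕜 (.b_start r)))

theorem induction_on {p : ZigzagAlg 𝕜 → Prop} (x : ZigzagAlg 𝕜) (he : ∀ r, p (e 𝕜 r))
    (ha : ∀ r, p (a 𝕜 r)) (hb : ∀ r, p (b 𝕜 r)) (zero : p 0)
    (add : ∀ x y, p x → p y → p (x + y)) (mul : ∀ x y, p x → p y → p (x * y))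
    (smul : ∀ (c : 𝕜) x, p x → p (c • x)) : p x := by
  obtain ⟨x, hx⟩ := x
  induction hx using NonUnitalAlgebra.adjoin_induction with
  | mem x h =>
    obtain ⟨g, rfl⟩ := h
    cases g with
    | e r => exact he r
    | a r => exact ha r
    | b r => exact hb r
  | zero => exact zero
  | add x y hx hy h h' => exact add ⟨x, hx⟩ ⟨y, hy⟩ h h'
  | mul x y hx hy h h' => exact mul ⟨x, hx⟩ ⟨y, hy⟩ h h'
  | smul c x hx h => exact smul c ⟨x, hx⟩ h

section Lift

variable {S : Type*} [Ring S] [Algebra 𝕜 S]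

/-- The universal property of the zig-zag algebra: images of the paths of length at most one which
satisfy the defining relations extend to a homomorphism of non-unital algebras. -/
def lift (f : ZigzagGen → S)
    (hf : ∀ ⦃x y⦄, ZigzagRel 𝕜 x y → FreeAlgebra.lift 𝕜 f x = FreeAlgebra.lift 𝕜 f y) :
    ZigzagAlg 𝕜 →ₙₐ[𝕜] S :=
  ((RingQuot.liftAlgHom 𝕜 ⟨FreeAlgebra.lift 𝕜 f, hf⟩ : RingQuot (ZigzagRel 𝕜) →ₐ[𝕜] S) :
    RingQuot (ZigzagRel 𝕜) →ₙₐ[𝕜] S).comp (NonUnitalSubalgebraClass.subtype (ZigzagAlg 𝕜))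

theorem lift_of (f : ZigzagGen → S)
    (hf : ∀ ⦃x y⦄, ZigzagRel 𝕜 x y → FreeAlgebra.lift 𝕜 f x = FreeAlgebra.lift 𝕜 f y)
    (g : ZigzagGen) : lift f hf (of 𝕜 g) = f g :=
  (RingQuot.liftAlgHom_mkAlgHom_apply 𝕜 _ hf _).trans (FreeAlgebra.lift_ι_apply f g)

end Lift

section PathOperator

open MulOpposite

variable {S : Type*} [Ring S]

/-- The operators of the paths of length at most one on a module with vertex projections `E r` and
globally defined anticommuting differentials `A` and `B`. As in `GInf`, the arrow `(r|r-1)` is `B`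
up to the sign `(-1)^r`; the opposite ring accounts for paths being composed from left to right. -/
def pathOperator (E : ℤ → S) (A B : S) : ZigzagGen → Sᵐᵒᵖ
  | .e r => op (E r)
  | .a r => op (A * E r)
  | .b r => op (r.negOnePow • (B * E r))

variable [Algebra 𝕜 S]

theorem lift_pathOperator_eq_of_rel {E : ℤ → S} {A B : S} (hE : ∀ r, E r * E r = E r)
    (hE' : ∀ r s, r ≠ s → E r * E s = 0) (hEA : ∀ r, E (r + 1) * A = A * E r)
    (hEB : ∀ r, E (r - 1) * B = B * E r) (hA : A * A = 0) (hB : B * B = 0)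
    (hAB : A * B + B * A = 0) ⦃x y : FreeAlgebra 𝕜 ZigzagGen⦄ (h : ZigzagRel 𝕜 x y) :
    FreeAlgebra.lift 𝕜 (pathOperator E A B) x = FreeAlgebra.lift 𝕜 (pathOperator E A B) y := by
  have hEA' (r : ℤ) (t : S) : E (r + 1) * (A * t) = A * (E r * t) := by
    rw [← mul_assoc, hEA, mul_assoc]
  have hEB' (r : ℤ) (t : S) : E (r - 1) * (B * t) = B * (E r * t) := by
    rw [← mul_assoc, hEB, mul_assoc]
  have hA' (t : S) : A * (A * t) = 0 := by rw [← mul_assoc, hA, zero_mul]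
  have hB' (t : S) : B * (B * t) = 0 := by rw [← mul_assoc, hB, zero_mul]
  have hAB' (t : S) : A * (B * t) = -(B * (A * t)) := by
    rw [← mul_assoc, eq_neg_of_add_eq_zero_left hAB, neg_mul, mul_assoc]
  apply unop_injective
  cases h with
  | orth r s h => simp [pathOperator, hE' s r h.symm]
  | loop r =>
    simp [pathOperator, mul_assoc, smul_mul_assoc, mul_smul_comm, hE, hEA', hEB', hAB',
      Int.negOnePow_succ, Units.neg_smul]
  | _ r =>
    simp [pathOperator, mul_assoc, smul_mul_assoc, mul_smul_comm, hE, hEA', hEB', hA', hB']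

end PathOperator

end ZigzagAlg

namespace GrMod

variable {𝕜 : Type u} [Field 𝕜]

theorem act_e_of_mem (M : GrMod 𝕜) {r j : ℤ} {m : M.carrier} (hm : m ∈ M.part r j) :
    M.act (ZigzagAlg.e 𝕜 r) m = m := by
  obtain ⟨_, x, rfl⟩ := hm
  rw [← M.act_mul, ZigzagAlg.e_mul_e]

theorem act_e_of_ne (M : GrMod 𝕜) {r s j : ℤ} (h : r ≠ s) {m : M.carrier} (hm : m ∈ M.part r j) :
    M.act (ZigzagAlg.e 𝕜 s) m = 0 := by
  obtain ⟨_, x, rfl⟩ := hm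
  rw [← M.act_mul, ZigzagAlg.e_mul_e_of_ne h, map_zero, LinearMap.zero_apply]

theorem act_a_of_ne (M : GrMod 𝕜) {r s j : ℤ} (h : r ≠ s) {m : M.carrier} (hm : m ∈ M.part r j) :
    M.act (ZigzagAlg.a 𝕜 s) m = 0 := by
  rw [← ZigzagAlg.e_mul_a, M.act_mul, M.act_e_of_ne h hm, map_zero]

theorem act_b_of_ne (M : GrMod 𝕜) {r s j : ℤ} (h : r ≠ s) {m : M.carrier} (hm : m ∈ M.part r j) :
    M.act (ZigzagAlg.b 𝕜 s) m = 0 := by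
  rw [← ZigzagAlg.e_mul_b, M.act_mul, M.act_e_of_ne h hm, map_zero]

theorem act_e_mem_gr (M : GrMod 𝕜) (r : ℤ) {j : ℤ} {m : M.carrier} (hm : m ∈ M.gr j) :
    M.act (ZigzagAlg.e 𝕜 r) m ∈ M.gr j := by
  simpa using M.act_mem (.e r) hm

theorem iSup_part (M : GrMod 𝕜) : ⨆ p : ℤ × ℤ, M.part (p.1 - p.2) p.2 = ⊤ := by
  rw [eq_top_iff, ← M.iSup_range]
  refine iSup_le fun r => ?_
  rw [LinearMap.range_eq_map, ← M.isInternal.submodule_iSup_eq_top, Submodule.map_iSup]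
  refine iSup_le fun j => ?_
  rintro _ ⟨x, hx, rfl⟩
  refine Submodule.mem_iSup_of_mem (r + j, j) ?_
  rw [add_sub_cancel_right]
  exact ⟨M.act_e_mem_gr r hx, x, rfl⟩

theorem isInternal_part (M : GrMod 𝕜) :
    DirectSum.IsInternal fun p : ℤ × ℤ => M.part (p.1 - p.2) p.2 := by
  rw [DirectSum.isInternal_submodule_iff_iSupIndep_and_iSup_eq_top]
  refine ⟨?_, M.iSup_part⟩
  choose P hP₁ hP₂ using exists_projection_of_isInternal M.isInternal
  refine iSupIndep_of_projections (fun p => P p.2 ∘ₗ M.act (ZigzagAlg.e 𝕜 (p.1 - p.2))) ?_ ?_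
  · intro p x hx
    rw [LinearMap.comp_apply, M.act_e_of_mem hx, hP₁ _ _ hx.1]
  · intro p q hpq x hx
    rw [LinearMap.comp_apply]
    by_cases h : q.2 = p.2
    · rw [M.act_e_of_ne (fun h' => hpq (Prod.ext (by omega) h)) hx, map_zero]
    · exact hP₂ _ _ h _ (M.act_e_mem_gr _ hx.1)

theorem linearMap_ext (M : GrMod 𝕜) {V : Type*} [AddCommGroup V] [Module 𝕜 V]
    {f g : M.carrier →ₗ[𝕜] V} (h : ∀ i j, ∀ x ∈ M.part (i - j) j, f x = g x) : f = g := by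
  rw [← LinearMap.eqLocus_eq_top, eq_top_iff, ← M.iSup_part]
  exact iSup_le fun p x hx => h p.1 p.2 x hx

theorem gr_le_iSup_part (M : GrMod 𝕜) (j : ℤ) : M.gr j ≤ ⨆ i, M.part (i - j) j := by
  obtain ⟨P, hP₁, hP₂⟩ := exists_projection_of_isInternal M.isInternal j
  have h : (⊤ : Submodule 𝕜 M.carrier) ≤ (⨆ i, M.part (i - j) j).comap P := by
    rw [← M.iSup_part]
    refine iSup_le fun p x hx => ?_
    rw [Submodule.mem_comap]
    by_cases h : p.2 = j
    · subst h
      rw [hP₁ x hx.1]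
      exact Submodule.mem_iSup_of_mem p.1 hx
    · rw [hP₂ _ h _ hx.1]
      exact zero_mem _
  intro m hm
  rw [← hP₁ m hm]
  exact h trivial

theorem epi_of_surjective {M N : GrMod 𝕜} (f : M ⟶ N) (hf : Function.Surjective f.lin) :
    Epi f where
  left_cancellation g h e := by
    ext y
    obtain ⟨x, rfl⟩ := hf y
    exact congrArg (fun t : M ⟶ _ => t.lin x) e

end GrMod

namespace GInf

variable {𝕜 : Type u} [Field 𝕜]

instance : (GInf 𝕜).Faithful where
  map_injective {M N f g} h := by
    ext k x
    refine LinearMap.congr_fun (GrMod.linearMap_ext _ fun i j x hx => ?_) x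
    exact congrArg (fun t : obj M ⟶ obj N => (t.app i j k ⟨x, hx⟩).1) h

section Full

variable {M N : CochainComplex (GrMod 𝕜) ℤ} (g : obj M ⟶ obj N)

/-- The linear map `f` assembles the components of `g` in degree `k`: this is how a morphism of
complexes is recovered from its image under `GInf`. -/
def Assembles (k : ℤ) (f : (M.X k).carrier →ₗ[𝕜] (N.X k).carrier) : Prop :=
  ∀ i j (x : (M.X k).part (i - j) j), f x = (g.app i j k x).1

theorem exists_assembles (k : ℤ) : ∃ f, Assembles g k f := by
  obtain ⟨f, hf⟩ := exists_linearMap_of_isInternal (M.X k).isInternal_part fun p =>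
    ((N.X k).part (p.1 - p.2) p.2).subtype ∘ₗ g.app p.1 p.2 k
  exact ⟨f, fun i j x => hf (i, j) x⟩

variable {g} {k : ℤ} {f : (M.X k).carrier →ₗ[𝕜] (N.X k).carrier}

namespace Assembles

theorem map_act_e (hf : Assembles g k f) (s : ℤ) {i j : ℤ} (x : (M.X k).part (i - j) j) :
    f ((M.X k).act (ZigzagAlg.e 𝕜 s) x) = (N.X k).act (ZigzagAlg.e 𝕜 s) (f x) := by
  rw [hf]
  by_cases h : i - j = s
  · subst h
    rw [GrMod.act_e_of_mem _ x.2, GrMod.act_e_of_mem _ (g.app i j k x).2, hf]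
  · rw [GrMod.act_e_of_ne _ h x.2, GrMod.act_e_of_ne _ h (g.app i j k x).2, map_zero]

theorem map_act_a (hf : Assembles g k f) (s : ℤ) {i j : ℤ} (x : (M.X k).part (i - j) j) :
    f ((M.X k).act (ZigzagAlg.a 𝕜 s) x) = (N.X k).act (ZigzagAlg.a 𝕜 s) (f x) := by
  rw [hf]
  by_cases h : i - j = s
  · subst h
    exact (hf _ _ (d1 M j k rfl x)).trans (congrArg Subtype.val (g.comm1 j k rfl x))
  · rw [GrMod.act_a_of_ne _ h x.2, GrMod.act_a_of_ne _ h (g.app i j k x).2, map_zero]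

theorem map_act_b (hf : Assembles g k f) (s : ℤ) {i j : ℤ} (x : (M.X k).part (i - j) j) :
    f ((M.X k).act (ZigzagAlg.b 𝕜 s) x) = (N.X k).act (ZigzagAlg.b 𝕜 s) (f x) := by
  rw [hf]
  by_cases h : i - j = s
  · subst h
    have hd := (hf _ _ (d2 M i k rfl x)).trans (congrArg Subtype.val (g.comm2 i k rfl x))
    exact smul_left_cancel (i - j).negOnePow ((map_zsmul f _ _).symm.trans hd)
  · rw [GrMod.act_b_of_ne _ h x.2, GrMod.act_b_of_ne _ h (g.app i j k x).2, map_zero]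

theorem comp_act (hf : Assembles g k f) (x : ZigzagAlg 𝕜) :
    f ∘ₗ (M.X k).act x = (N.X k).act x ∘ₗ f := by
  induction x using ZigzagAlg.induction_on with
  | he s => exact (M.X k).linearMap_ext fun i j x hx => hf.map_act_e s ⟨x, hx⟩
  | ha s => exact (M.X k).linearMap_ext fun i j x hx => hf.map_act_a s ⟨x, hx⟩
  | hb s => exact (M.X k).linearMap_ext fun i j x hx => hf.map_act_b s ⟨x, hx⟩
  | zero => simp
  | add x y hx hy => simp only [map_add, LinearMap.comp_add, LinearMap.add_comp, hx, hy]
  | mul x y hx hy =>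
    ext m
    have hx (m) := LinearMap.congr_fun hx m
    have hy (m) := LinearMap.congr_fun hy m
    simp only [LinearMap.comp_apply, GrMod.act_mul] at hx hy ⊢
    rw [hy, hx]
  | smul c x hx => simp only [map_smul, LinearMap.comp_smul, LinearMap.smul_comp, hx]

theorem map_gr (hf : Assembles g k f) {j : ℤ} {m : (M.X k).carrier} (hm : m ∈ (M.X k).gr j) :
    f m ∈ (N.X k).gr j := by
  have h : ⨆ i, (M.X k).part (i - j) j ≤ ((N.X k).gr j).comap f := iSup_le fun i x hx => by
    rw [Submodule.mem_comap, hf i j ⟨x, hx⟩]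
    exact (g.app i j k ⟨x, hx⟩).2.1
  exact h ((M.X k).gr_le_iSup_part j hm)

theorem comp_d (hf : Assembles g k f) {k' : ℤ} {f' : (M.X k').carrier →ₗ[𝕜] (N.X k').carrier}
    (hf' : Assembles g k' f') (h : k + 1 = k') :
    f' ∘ₗ (M.d k k').lin = (N.d k k').lin ∘ₗ f := by
  refine (M.X k).linearMap_ext fun i j x hx => ?_
  have hd := (hf' _ _ (d3 M i j h ⟨x, hx⟩)).trans (congrArg Subtype.val (g.comm3 i j h ⟨x, hx⟩))
  exact (smul_left_cancel (i - j + k).negOnePow ((map_zsmul f' _ _).symm.trans hd)).trans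
    (congrArg _ (hf i j ⟨x, hx⟩).symm)

end Assembles

instance : (GInf 𝕜).Full where
  map_surjective {M N} g := by
    choose f hf using exists_assembles (M := M) (N := N) g
    refine ⟨{ f := fun k => ⟨f k, fun x => LinearMap.congr_fun ((hf k).comp_act x), (hf k).map_gr⟩,
              comm' := ?_ }, ?_⟩
    · intro k k' h
      ext m
      exact (LinearMap.congr_fun ((hf k).comp_d (hf k') h) m).symm
    · ext i j k x
      exact Subtype.ext (hf k i j x)

end Full

end GInf

namespace TriMod

variable {𝕜 : Type u} [Field 𝕜]

theorem isIso_of_bijective {M N : TriMod 𝕜} (f : M ⟶ N)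
    (hf : ∀ i j k, Function.Bijective (f.app i j k)) : IsIso f := by
  let e := fun i j k => LinearEquiv.ofBijective (f.app i j k) (hf i j k)
  have he (i j k x) : f.app i j k ((e i j k).symm x) = x := (e i j k).apply_symm_apply x
  have he' (i j k x) : (e i j k).symm (f.app i j k x) = x := (e i j k).symm_apply_apply x
  refine ⟨⟨fun i j k => (e i j k).symm.toLinearMap, fun j k h x => (hf _ _ _).1 ?_,
    fun i {_ _} k h x => (hf _ _ _).1 ?_, fun i j {_ _} h x => (hf _ _ _).1 ?_⟩, ?_, ?_⟩
  · simp [f.comm1, he]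
  · simp [f.comm2, he]
  · simp [f.comm3, he]
  · ext i j k x
    exact he' i j k x
  · ext i j k x
    exact he i j k x

section Total

variable (T : TriMod 𝕜)

/-- The direct sum of the components `T.X i j k` for a fixed `k`: the vector space underlying the
graded `A`-module in degree `k` of the complex that `GInf` sends to `T`. -/
abbrev Total (k : ℤ) : Type u := DirectSum (ℤ × ℤ) fun p => T.X p.1 p.2 k

/-- The inclusion of a component in the direct sum. -/
abbrev incl (i j k : ℤ) : T.X i j k →ₗ[𝕜] T.Total k :=
  DirectSum.lof 𝕜 (ℤ × ℤ) (fun p => T.X p.1 p.2 k) (i, j)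

open scoped Classical in
/-- The projection of the direct sum onto the components with index in `s`. -/
noncomputable def totalProj (k : ℤ) (s : Set (ℤ × ℤ)) :
    Module.End 𝕜 (T.Total k) :=
  DirectSum.toModule 𝕜 _ _ fun p => if p ∈ s then T.incl p.1 p.2 k else 0

/-- The projection onto the part at the vertex `r`. -/
noncomputable abbrev vertexProj (k r : ℤ) : Module.End 𝕜 (T.Total k) :=
  T.totalProj k {p | p.1 - p.2 = r}

/-- The projection onto the part of degree `j`. -/
noncomputable abbrev degreeProj (k j : ℤ) : Module.End 𝕜 (T.Total k) :=
  T.totalProj k {p | p.2 = j}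

/-- The operator `∂₁` on the direct sum. -/
def total1 (k : ℤ) : Module.End 𝕜 (T.Total k) :=
  DirectSum.toModule 𝕜 _ _ fun p => T.incl (p.1 + 1) p.2 k ∘ₗ T.d1 p.2 k rfl

/-- The operator `∂₂` on the direct sum. -/
def total2 (k : ℤ) : Module.End 𝕜 (T.Total k) :=
  DirectSum.toModule 𝕜 _ _ fun p => T.incl p.1 (p.2 + 1) k ∘ₗ T.d2 p.1 k rfl

/-- The operator `∂₃` on the direct sum, up to the sign of `GInf.d3`, which makes it commute with
`∂₁` and `∂₂`. -/
def total3 {k k' : ℤ} (h : k + 1 = k') : T.Total k →ₗ[𝕜] T.Total k' :=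
  DirectSum.toModule 𝕜 _ _ fun p =>
    (p.1 - p.2 + k).negOnePow • (T.incl p.1 p.2 k' ∘ₗ T.d3 p.1 p.2 h)

variable {T} {i j k k' : ℤ}

theorem total_ext {V : Type*} [AddCommGroup V] [Module 𝕜 V] {f g : T.Total k →ₗ[𝕜] V}
    (h : ∀ i j x, f (T.incl i j k x) = g (T.incl i j k x)) : f = g :=
  DirectSum.linearMap_ext _ fun p => LinearMap.ext fun x => h p.1 p.2 x

theorem eq_top_of_incl_mem {q : Submodule 𝕜 (T.Total k)} (h : ∀ i j x, T.incl i j k x ∈ q) :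
    q = ⊤ := by
  rw [← q.ker_mkQ, LinearMap.ker_eq_top]
  exact total_ext fun i j x => (Submodule.Quotient.mk_eq_zero q).mpr (h i j x)

theorem incl_injective : Function.Injective (T.incl i j k) :=
  DirectSum.of_injective (β := fun p : ℤ × ℤ => T.X p.1 p.2 k) (i, j)

theorem total1_incl (x : T.X i j k) :
    T.total1 k (T.incl i j k x) = T.incl (i + 1) j k (T.d1 j k rfl x) := by
  rw [total1, DirectSum.toModule_lof, LinearMap.comp_apply]

theorem total2_incl (x : T.X i j k) :
    T.total2 k (T.incl i j k x) = T.incl i (j + 1) k (T.d2 i k rfl x) := by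
  rw [total2, DirectSum.toModule_lof, LinearMap.comp_apply]

theorem total3_incl (h : k + 1 = k') (x : T.X i j k) :
    T.total3 h (T.incl i j k x) = (i - j + k).negOnePow • T.incl i j k' (T.d3 i j h x) := by
  rw [total3, DirectSum.toModule_lof, LinearMap.smul_apply, LinearMap.comp_apply]

section Projections

variable {s t : Set (ℤ × ℤ)}

theorem totalProj_incl_of_mem (h : (i, j) ∈ s) (x : T.X i j k) :
    T.totalProj k s (T.incl i j k x) = T.incl i j k x := by
  rw [totalProj, DirectSum.toModule_lof, if_pos h]

theorem totalProj_incl_of_notMem (h : (i, j) ∉ s) (x : T.X i j k) :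
    T.totalProj k s (T.incl i j k x) = 0 := by
  rw [totalProj, DirectSum.toModule_lof, if_neg h, LinearMap.zero_apply]

theorem vertexProj_incl (x : T.X i j k) :
    T.vertexProj k (i - j) (T.incl i j k x) = T.incl i j k x :=
  totalProj_incl_of_mem (s := {p | p.1 - p.2 = i - j}) rfl x

theorem degreeProj_incl (x : T.X i j k) : T.degreeProj k j (T.incl i j k x) = T.incl i j k x :=
  totalProj_incl_of_mem (s := {p | p.2 = j}) rfl x

theorem totalProj_mul (s t : Set (ℤ × ℤ)) :
    T.totalProj k s * T.totalProj k t = T.totalProj k (s ∩ t) := by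
  refine total_ext fun i j x => ?_
  rw [Module.End.mul_apply]
  by_cases ht : (i, j) ∈ t
  · rw [totalProj_incl_of_mem ht]
    by_cases hs : (i, j) ∈ s
    · rw [totalProj_incl_of_mem hs, totalProj_incl_of_mem (Set.mem_inter hs ht)]
    · rw [totalProj_incl_of_notMem hs, totalProj_incl_of_notMem fun h => hs h.1]
  · rw [totalProj_incl_of_notMem ht, map_zero, totalProj_incl_of_notMem fun h => ht h.2]

theorem totalProj_mul_self (s : Set (ℤ × ℤ)) :
    T.totalProj k s * T.totalProj k s = T.totalProj k s := by
  rw [totalProj_mul, Set.inter_self]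

theorem totalProj_mul_of_disjoint (h : Disjoint s t) :
    T.totalProj k s * T.totalProj k t = 0 := by
  rw [totalProj_mul, h.inter_eq]
  exact total_ext fun i j x => totalProj_incl_of_notMem (Set.notMem_empty _) x

theorem totalProj_apply_of_mem_range {m : T.Total k} (hm : m ∈ LinearMap.range (T.totalProj k s)) :
    T.totalProj k s m = m := by
  obtain ⟨y, rfl⟩ := hm
  exact LinearMap.congr_fun (totalProj_mul_self s) y

theorem totalProj_comp {f : T.Total k →ₗ[𝕜] T.Total k'} (φ : ℤ × ℤ → ℤ × ℤ)
    (hf : ∀ i j x, ∃ y, f (T.incl i j k x) = T.incl (φ (i, j)).1 (φ (i, j)).2 k' y)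
    (hst : ∀ p, φ p ∈ t ↔ p ∈ s) : T.totalProj k' t ∘ₗ f = f ∘ₗ T.totalProj k s := by
  refine total_ext fun i j x => ?_
  obtain ⟨y, hy⟩ := hf i j x
  rw [LinearMap.comp_apply, LinearMap.comp_apply]
  by_cases hs : (i, j) ∈ s
  · rw [totalProj_incl_of_mem hs, hy, totalProj_incl_of_mem ((hst _).mpr hs)]
  · rw [totalProj_incl_of_notMem hs, hy, totalProj_incl_of_notMem (mt (hst _).mp hs), map_zero]

theorem totalProj_mul_total1 (h : ∀ p : ℤ × ℤ, (p.1 + 1, p.2) ∈ t ↔ p ∈ s) :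
    T.totalProj k t * T.total1 k = T.total1 k * T.totalProj k s :=
  totalProj_comp (fun p => (p.1 + 1, p.2)) (fun _ _ x => ⟨_, total1_incl x⟩) h

theorem totalProj_mul_total2 (h : ∀ p : ℤ × ℤ, (p.1, p.2 + 1) ∈ t ↔ p ∈ s) :
    T.totalProj k t * T.total2 k = T.total2 k * T.totalProj k s :=
  totalProj_comp (fun p => (p.1, p.2 + 1)) (fun _ _ x => ⟨_, total2_incl x⟩) h

theorem totalProj_comp_total3 (h : k + 1 = k') (s : Set (ℤ × ℤ)) :
    T.totalProj k' s ∘ₗ T.total3 h = T.total3 h ∘ₗ T.totalProj k s :=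
  totalProj_comp id
    (fun _ _ x => ⟨_, (total3_incl h x).trans (LinearMap.map_smul_of_tower _ _ _).symm⟩)
    fun _ => Iff.rfl

end Projections

theorem total1_mul_total1 : T.total1 k * T.total1 k = 0 :=
  total_ext fun i j x => by simp [total1_incl, T.d1_d1]

theorem total2_mul_total2 : T.total2 k * T.total2 k = 0 :=
  total_ext fun i j x => by simp [total2_incl, T.d2_d2]

theorem total1_mul_total2_add : T.total1 k * T.total2 k + T.total2 k * T.total1 k = 0 :=
  total_ext fun i j x => by
    simp [total1_incl, total2_incl, eq_neg_of_add_eq_zero_left (T.d1_d2 k rfl rfl x)]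

theorem total3_comp_total1 (h : k + 1 = k') :
    T.total3 h ∘ₗ T.total1 k = T.total1 k' ∘ₗ T.total3 h :=
  total_ext fun i j x => by
    simp [total1_incl, total3_incl,
      eq_neg_of_add_eq_zero_left (T.d1_d3 j rfl h x), Int.negOnePow_succ, Units.neg_smul,
      show i + 1 - j + k = i - j + k + 1 by ring]

theorem total3_comp_total2 (h : k + 1 = k') :
    T.total3 h ∘ₗ T.total2 k = T.total2 k' ∘ₗ T.total3 h :=
  total_ext fun i j x => by
    simp [total2_incl, total3_incl,
      eq_neg_of_add_eq_zero_left (T.d2_d3 i rfl h x), Int.negOnePow_succ, Units.neg_smul,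
      show i - j + k = i - (j + 1) + k + 1 by ring]

theorem total3_comp_total3 {k'' : ℤ} (h : k + 1 = k') (h' : k' + 1 = k'') :
    T.total3 h' ∘ₗ T.total3 h = 0 :=
  total_ext fun i j x => by
    simp [total3_incl, T.d3_d3]

theorem totalProj_singleton_mem_range (m : T.Total k) :
    T.totalProj k {(i, j)} m ∈ LinearMap.range (T.incl i j k) := by
  have h : T.totalProj k {(i, j)} =
      T.incl i j k ∘ₗ DirectSum.component 𝕜 _ (fun p : ℤ × ℤ => T.X p.1 p.2 k) (i, j) := by
    refine total_ext fun i' j' x => ?_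
    rw [LinearMap.comp_apply]
    by_cases hp : (i', j') = (i, j)
    · cases hp
      rw [totalProj_incl_of_mem (Set.mem_singleton _), DirectSum.component.lof_self]
    · rw [totalProj_incl_of_notMem (mt Set.mem_singleton_iff.mp hp), DirectSum.component.of,
        dif_neg hp, map_zero]
  rw [h]
  exact ⟨_, rfl⟩

section Action

/-- The action of the zig-zag algebra on the direct sum, as a homomorphism to the opposite of the
endomorphism ring. -/
noncomputable def totalHom (T : TriMod 𝕜) (k : ℤ) :
    ZigzagAlg 𝕜 →ₙₐ[𝕜] (Module.End 𝕜 (T.Total k))ᵐᵒᵖ :=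
  ZigzagAlg.lift (ZigzagAlg.pathOperator (T.vertexProj k) (T.total1 k) (T.total2 k))
    (ZigzagAlg.lift_pathOperator_eq_of_rel (fun _ => totalProj_mul_self _)
      (fun _ _ h => totalProj_mul_of_disjoint
        (Set.disjoint_left.mpr fun _ hp hp' => h (hp.symm.trans hp')))
      (fun r => totalProj_mul_total1 fun p => by simp only [Set.mem_ofPred_eq]; omega)
      (fun r => totalProj_mul_total2 fun p => by simp only [Set.mem_ofPred_eq]; omega)
      total1_mul_total1 total2_mul_total2 total1_mul_total2_add)

/-- The action of the zig-zag algebra on the direct sum. -/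
noncomputable def totalAct (T : TriMod 𝕜) (k : ℤ) :
    ZigzagAlg 𝕜 →ₗ[𝕜] Module.End 𝕜 (T.Total k) :=
  (MulOpposite.opLinearEquiv 𝕜).symm.toLinearMap ∘ₗ
    (T.totalHom k : ZigzagAlg 𝕜 →ₗ[𝕜] (Module.End 𝕜 (T.Total k))ᵐᵒᵖ)

theorem totalAct_mul (x y : ZigzagAlg 𝕜) :
    T.totalAct k (x * y) = T.totalAct k y * T.totalAct k x :=
  congrArg MulOpposite.unop (map_mul (T.totalHom k) x y)

theorem totalAct_e (r : ℤ) : T.totalAct k (ZigzagAlg.e 𝕜 r) = T.vertexProj k r :=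
  congrArg MulOpposite.unop (ZigzagAlg.lift_of (𝕜 := 𝕜) _ _ (.e r))

theorem totalAct_a (r : ℤ) :
    T.totalAct k (ZigzagAlg.a 𝕜 r) = T.total1 k * T.vertexProj k r :=
  congrArg MulOpposite.unop (ZigzagAlg.lift_of (𝕜 := 𝕜) _ _ (.a r))

theorem totalAct_b (r : ℤ) :
    T.totalAct k (ZigzagAlg.b 𝕜 r) = r.negOnePow • (T.total2 k * T.vertexProj k r) :=
  congrArg MulOpposite.unop (ZigzagAlg.lift_of (𝕜 := 𝕜) _ _ (.b r))

theorem totalAct_e_incl (x : T.X i j k) :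
    T.totalAct k (ZigzagAlg.e 𝕜 (i - j)) (T.incl i j k x) = T.incl i j k x := by
  rw [totalAct_e, vertexProj_incl]

theorem totalAct_a_incl (x : T.X i j k) :
    T.totalAct k (ZigzagAlg.a 𝕜 (i - j)) (T.incl i j k x) =
      T.incl (i + 1) j k (T.d1 j k rfl x) := by
  rw [totalAct_a, Module.End.mul_apply, vertexProj_incl, total1_incl]

theorem totalAct_b_incl (x : T.X i j k) :
    T.totalAct k (ZigzagAlg.b 𝕜 (i - j)) (T.incl i j k x) =
      (i - j).negOnePow • T.incl i (j + 1) k (T.d2 i k rfl x) := by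
  rw [totalAct_b, LinearMap.smul_apply, Module.End.mul_apply, vertexProj_incl,
    total2_incl]

theorem degreeProj_mul_totalAct {x : ZigzagAlg 𝕜} {d : ℤ} (hx : ZigzagAlg.HasDegree x d) (j : ℤ) :
    T.degreeProj k (j + d) * T.totalAct k x = T.totalAct k x * T.degreeProj k j := by
  have hE (r j : ℤ) :
      T.degreeProj k j * T.vertexProj k r = T.vertexProj k r * T.degreeProj k j := by
    rw [totalProj_mul, totalProj_mul, Set.inter_comm]
  induction hx generalizing j with
  | e r => rw [totalAct_e, add_zero, hE]
  | a r =>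
    have hA : T.degreeProj k j * T.total1 k = T.total1 k * T.degreeProj k j :=
      totalProj_mul_total1 fun _ => Iff.rfl
    rw [totalAct_a, add_zero, ← mul_assoc, hA, mul_assoc, hE, mul_assoc]
  | b r =>
    have hB : T.degreeProj k (j + 1) * T.total2 k = T.total2 k * T.degreeProj k j :=
      totalProj_mul_total2 fun _ => add_left_inj 1
    rw [totalAct_b, mul_smul_comm, smul_mul_assoc, ← mul_assoc, hB, mul_assoc, hE, mul_assoc]
  | mul _ _ hx hy => rw [totalAct_mul, ← add_assoc, ← mul_assoc, hy, mul_assoc, hx, mul_assoc]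
  | zero => rw [map_zero, mul_zero, zero_mul]
  | add _ _ hx hy => rw [map_add, mul_add, add_mul, hx, hy]
  | smul c _ hx => rw [map_smul, mul_smul_comm, smul_mul_assoc, hx]

theorem total3_comp_totalAct (h : k + 1 = k') (x : ZigzagAlg 𝕜) :
    T.total3 h ∘ₗ T.totalAct k x = T.totalAct k' x ∘ₗ T.total3 h := by
  have hE (r : ℤ) : T.total3 h ∘ₗ T.vertexProj k r = T.vertexProj k' r ∘ₗ T.total3 h :=
    (totalProj_comp_total3 h _).symm
  induction x using ZigzagAlg.induction_on with
  | he r => rw [totalAct_e, totalAct_e, hE]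
  | ha r =>
    rw [totalAct_a, totalAct_a, Module.End.mul_eq_comp, Module.End.mul_eq_comp,
      ← LinearMap.comp_assoc, total3_comp_total1, LinearMap.comp_assoc, hE, LinearMap.comp_assoc]
  | hb r =>
    rw [totalAct_b, totalAct_b, Module.End.mul_eq_comp, Module.End.mul_eq_comp,
      LinearMap.smul_comp, LinearMap.comp_smul, ← LinearMap.comp_assoc, total3_comp_total2,
      LinearMap.comp_assoc, hE, LinearMap.comp_assoc]
  | zero => rw [map_zero, map_zero, LinearMap.comp_zero, LinearMap.zero_comp]
  | add x y hx hy => rw [map_add, map_add, LinearMap.comp_add, LinearMap.add_comp, hx, hy]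
  | mul x y hx hy =>
    rw [totalAct_mul, totalAct_mul, Module.End.mul_eq_comp, Module.End.mul_eq_comp,
      ← LinearMap.comp_assoc, hy, LinearMap.comp_assoc, hx, LinearMap.comp_assoc]
  | smul c x hx => rw [map_smul, map_smul, LinearMap.comp_smul, LinearMap.smul_comp, hx]

end Action

theorem isInternal_range_degreeProj (T : TriMod 𝕜) (k : ℤ) :
    DirectSum.IsInternal fun j => LinearMap.range (T.degreeProj k j) := by
  rw [DirectSum.isInternal_submodule_iff_iSupIndep_and_iSup_eq_top]
  constructor
  · refine iSupIndep_of_projections (T.degreeProj k)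
      (fun j m hm => totalProj_apply_of_mem_range hm) ?_
    rintro j j' hj _ ⟨m, rfl⟩
    exact LinearMap.congr_fun (totalProj_mul_of_disjoint
      (Set.disjoint_left.mpr fun _ hp hp' => hj (hp'.symm.trans hp))) m
  · exact eq_top_of_incl_mem fun i j x =>
      Submodule.mem_iSup_of_mem j ⟨T.incl i j k x, degreeProj_incl x⟩

/-- The graded `A`-module `⨁ T.X i j k` attached to a trigraded module and a degree `k`. -/
noncomputable def toGrMod (T : TriMod 𝕜) (k : ℤ) : GrMod 𝕜 where
  carrier := T.Total k
  act := T.totalAct k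
  act_mul x y := LinearMap.congr_fun (totalAct_mul x y)
  gr j := LinearMap.range (T.degreeProj k j)
  isInternal := T.isInternal_range_degreeProj k
  act_mem := by
    rintro x d hx j _ ⟨m, rfl⟩
    exact ⟨_, LinearMap.congr_fun (degreeProj_mul_totalAct hx j) m⟩
  iSup_range := eq_top_of_incl_mem fun i j x =>
    Submodule.mem_iSup_of_mem (i - j) ⟨T.incl i j k x, totalAct_e_incl x⟩

/-- The complex of graded `A`-modules attached to a trigraded module: a preimage under `GInf`. -/
noncomputable def toComplex (T : TriMod 𝕜) : CochainComplex (GrMod 𝕜) ℤ where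
  X := T.toGrMod
  d k k' := if h : k + 1 = k' then
    { lin := T.total3 h
      map_act := fun x => LinearMap.congr_fun (total3_comp_totalAct h x)
      map_gr := by
        rintro j _ ⟨m, rfl⟩
        exact ⟨_, LinearMap.congr_fun (totalProj_comp_total3 h _) m⟩ } else 0
  shape k k' h := dif_neg h
  d_comp_d' k k' k'' h h' := by
    rw [dif_pos (c := k + 1 = k') h, dif_pos (c := k' + 1 = k'') h']
    ext m
    exact LinearMap.congr_fun (total3_comp_total3 h h') m

theorem toComplex_d_lin (h : k + 1 = k') : (T.toComplex.d k k').lin = T.total3 h :=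
  congrArg GrMod.Hom.lin (dif_pos h)

theorem part_toGrMod : (T.toGrMod k).part (i - j) j = LinearMap.range (T.incl i j k) := by
  change LinearMap.range (T.degreeProj k j) ⊓ LinearMap.range (T.totalAct k _) = _
  rw [totalAct_e]
  apply le_antisymm
  · rintro m ⟨hm, hm'⟩
    have hs : ({p | p.2 = j} ∩ {p | p.1 - p.2 = i - j} : Set (ℤ × ℤ)) = {(i, j)} := by
      ext ⟨i', j'⟩
      simp only [Set.mem_inter_iff, Set.mem_ofPred_eq, Set.mem_singleton_iff, Prod.mk.injEq]
      omega
    have hm'' : T.totalProj k {(i, j)} m = m := by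
      rw [← hs, ← totalProj_mul, Module.End.mul_apply, totalProj_apply_of_mem_range hm',
        totalProj_apply_of_mem_range hm]
    exact hm'' ▸ totalProj_singleton_mem_range m
  · rintro _ ⟨x, rfl⟩
    exact ⟨⟨_, degreeProj_incl x⟩, _, vertexProj_incl x⟩

/-- The comparison of a trigraded module with the image under `GInf` of its complex. -/
noncomputable def toGInf (T : TriMod 𝕜) : T ⟶ GInf.obj T.toComplex where
  app i j k := (T.incl i j k).codRestrict ((T.toGrMod k).part (i - j) j)
    fun x => part_toGrMod.ge ⟨x, rfl⟩
  comm1 j k h x := by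
    subst h
    exact Subtype.ext (totalAct_a_incl x).symm
  comm2 i {j j'} k h x := by
    subst h
    refine Subtype.ext (Eq.symm ?_)
    change (i - j).negOnePow • T.totalAct k (ZigzagAlg.b 𝕜 (i - j)) (T.incl i j k x) = _
    rw [totalAct_b_incl, smul_smul, Int.units_mul_self, one_smul]
    rfl
  comm3 i j {k k'} h x := by
    refine Subtype.ext (Eq.symm ?_)
    refine (congrArg ((i - j + k).negOnePow • ·)
      (LinearMap.congr_fun (toComplex_d_lin h) (T.incl i j k x))).trans ?_
    change (i - j + k).negOnePow • T.total3 h (T.incl i j k x) = _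
    rw [total3_incl, smul_smul, Int.units_mul_self, one_smul]
    rfl

instance (T : TriMod 𝕜) : IsIso T.toGInf :=
  isIso_of_bijective _ fun _ _ _ =>
    ⟨fun _ _ h => incl_injective (congrArg Subtype.val h), fun y =>
      (part_toGrMod.le y.2).imp fun _ => Subtype.ext⟩

end Total

end TriMod

namespace GInf

variable (𝕜 : Type u) [Field 𝕜]

instance : (GInf 𝕜).EssSurj where
  mem_essImage T := ⟨T.toComplex, ⟨(asIso T.toGInf).symm⟩⟩

instance : (GInf 𝕜).IsEquivalence where

end GInf

section MappingCone

open CochainComplex CochainComplex.HomComplex CochainComplex.mappingCone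

variable {C : Type*} [Category* C] [Preadditive C] [HasBinaryBiproducts C]
  {K L : CochainComplex C ℤ}

theorem isPushout_mappingConeMap (f : K ⟶ L) :
    IsPushout f (inr (𝟙 K)) (inr f) (mappingCone.map (𝟙 K) f (𝟙 K) f (by simp)) where
  w := by simp [mappingCone.map]
  isColimit' := ⟨PushoutCocone.IsColimit.mk _
    (fun s => desc f ((inl (𝟙 K)).comp (Cochain.ofHom s.inr) (add_zero _)) s.inl (by
      simp [s.condition]))
    (fun s => by simp)
    (fun s => by
      ext n
      have h := HomologicalComplex.congr_hom s.condition n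
      rw [ext_from_iff _ (n + 1) n rfl]
      constructor
      · simp [mappingCone.map]
      · simpa [mappingCone.map] using h)
    (fun s m h₁ h₂ => by
      ext n
      rw [ext_from_iff _ (n + 1) n rfl]
      constructor
      · simp [← h₂, mappingCone.map]
      · simp [← h₁])⟩

/-- The projection of the mapping cone of `f` to the shift of its source, the third morphism of
the triangle of the mapping cone. -/
noncomputable def mappingConeδ (f : K ⟶ L) : mappingCone f ⟶ K⟦(1 : ℤ)⟧ :=
  (triangle f).mor₃

theorem inr_comp_mappingConeδ (f : K ⟶ L) : inr f ≫ mappingConeδ f = 0 :=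
  inr_triangleδ f

theorem map_comp_mappingConeδ {K' L' : CochainComplex C ℤ} (f : K ⟶ L) (f' : K' ⟶ L')
    (a : K ⟶ K') (b : L ⟶ L') (comm : f ≫ b = a ≫ f') :
    mappingCone.map f f' a b comm ≫ mappingConeδ f' = mappingConeδ f ≫ a⟦(1 : ℤ)⟧' :=
  (triangleMap f f' a b comm).comm₃.symm

noncomputable def isColimitMappingConeδ [HasZeroObject C] (f : K ⟶ L) :
    IsColimit (CokernelCofork.ofπ (mappingConeδ f) (inr_comp_mappingConeδ f)) :=
  HomologicalComplex.isColimitOfEval _ _ fun n =>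
    (CokernelCofork.isColimitMapCoconeEquiv _ _).symm
      (triangleRotateShortComplexSplitting f n).gIsCokernel

theorem exists_sub_eq_inr_comp_of_homotopy {f g : K ⟶ L} (h : Homotopy f g) :
    ∃ w, f - g = inr (𝟙 K) ≫ w :=
  ⟨desc (𝟙 K) (Cochain.ofHomotopy h) (f - g) (by
    rw [δ_ofHomotopy, Category.id_comp, Cochain.ofHom_sub]), by simp⟩

theorem exists_lift_mappingCone_id_of_epi [∀ n, Projective (K.X n)] {E X : CochainComplex C ℤ}
    (g : mappingCone (𝟙 K) ⟶ X) (e : E ⟶ X) [∀ n, Epi (e.f n)] : ∃ h, h ≫ e = g := by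
  let α : Cochain K X (-1) := (inl (𝟙 K)).comp (Cochain.ofHom g) (add_zero _)
  let α' : Cochain K E (-1) := Cochain.mk fun p q hpq =>
    Projective.factorThru (α.v p q hpq) (e.f q)
  have hα : α'.comp (Cochain.ofHom e) (add_zero _) = α := by
    ext p q hpq
    simp [α', Projective.factorThru_comp]
  let β : Cocycle K E 0 := Cocycle.mk (δ (-1) 0 α') 1 (by lia) (δ_δ _ _ _ _)
  have hβ : Cocycle.homOf β ≫ e = inr (𝟙 K) ≫ g := by
    apply Cochain.ofHom_injective
    have h := congrArg (δ (-1) 0) hα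
    rw [δ_comp_ofHom] at h
    simp [β, h, α]
  refine ⟨desc (𝟙 K) α' (Cocycle.homOf β) (by simp [β]), ?_⟩
  ext n
  rw [ext_from_iff _ (n + 1) n rfl]
  constructor
  · simpa [α] using Cochain.congr_v hα (n + 1) n (by lia)
  · simpa using HomologicalComplex.congr_hom hβ n

end MappingCone

section Cosyzygy

variable {C : Type*} [Category* C] [Preadditive C]

/-- A cosyzygy of `M` relative to the projective objects: a morphism `i` from `M` to a projective
object `J` through which all morphisms from `M` to projective objects factor, together with its
cokernel `S`. The stable shift of `M` may be computed from any of them. -/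
structure Cosyzygy (M : C) where
  {J S : C}
  i : M ⟶ J
  p : J ⟶ S
  zero : i ≫ p = 0
  isColimit : IsColimit (CokernelCofork.ofπ p zero)
  projective : Projective J
  exists_extension {P : C} [Projective P] (g : M ⟶ P) : ∃ h, i ≫ h = g

namespace Cosyzygy

/-- The morphism `σ` of cosyzygies is induced by `f` through some extension of `f`. -/
def Induces {M M' : C} (E : Cosyzygy M) (E' : Cosyzygy M') (f : M ⟶ M') (σ : E.S ⟶ E'.S) : Prop :=
  ∃ A : E.J ⟶ E'.J, E.i ≫ A = f ≫ E'.i ∧ E.p ≫ σ = A ≫ E'.p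

variable {M M' M'' : C} {E : Cosyzygy M} {E' : Cosyzygy M'} {E'' : Cosyzygy M''}

theorem hom_ext {Z : C} {a b : E.S ⟶ Z} (h : E.p ≫ a = E.p ≫ b) : a = b :=
  Cofork.IsColimit.hom_ext E.isColimit h

theorem exists_desc {Z : C} (g : E.J ⟶ Z) (hg : E.i ≫ g = 0) : ∃ w, E.p ≫ w = g :=
  ⟨_, (CokernelCofork.IsColimit.desc' E.isColimit g hg).2⟩

variable (E E') in
theorem exists_induces (f : M ⟶ M') : ∃ σ, E.Induces E' f σ := by
  have := E'.projective
  obtain ⟨A, hA⟩ := E.exists_extension (f ≫ E'.i)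
  obtain ⟨σ, hσ⟩ := E.exists_desc (A ≫ E'.p) (by
    rw [← Category.assoc, hA, Category.assoc, E'.zero, comp_zero])
  exact ⟨σ, A, hA, hσ⟩

variable (E) in
theorem induces_id : E.Induces E (𝟙 M) (𝟙 E.S) :=
  ⟨𝟙 _, by simp, by simp⟩

theorem Induces.comp {f : M ⟶ M'} {f' : M' ⟶ M''} {σ : E.S ⟶ E'.S} {σ' : E'.S ⟶ E''.S}
    (h : E.Induces E' f σ) (h' : E'.Induces E'' f' σ') : E.Induces E'' (f ≫ f') (σ ≫ σ') := by
  obtain ⟨A, hA, hσ⟩ := h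
  obtain ⟨A', hA', hσ'⟩ := h'
  refine ⟨A ≫ A', ?_, ?_⟩
  · rw [reassoc_of% hA, hA', Category.assoc]
  · rw [reassoc_of% hσ, hσ', Category.assoc]

/-- A cone of `f` formed with a cosyzygy of its source: the pushout of `f` and of the embedding
in the projective object, with its projection to the cosyzygy. -/
structure Cone (E : Cosyzygy M) {N : C} (f : M ⟶ N) where
  {obj : C}
  c : N ⟶ obj
  e : E.J ⟶ obj
  δ : obj ⟶ E.S
  isPushout : IsPushout f E.i c e
  c_comp_δ : c ≫ δ = 0
  e_comp_δ : e ≫ δ = E.p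

namespace Cone

variable {N : C} {f : M ⟶ N} {F₁ F₂ F₃ : Cosyzygy M}

/-- The morphism `g` of cones of the same morphism is induced by the identity through a
comparison `A` of the projective objects. -/
def Induces (K : F₁.Cone f) (K' : F₂.Cone f) (g : K.obj ⟶ K'.obj) : Prop :=
  ∃ A : F₁.J ⟶ F₂.J, F₁.i ≫ A = F₂.i ∧ K.c ≫ g = K'.c ∧ K.e ≫ g = A ≫ K'.e

variable {K : F₁.Cone f} {K' : F₂.Cone f} {K'' : F₃.Cone f}

variable (K K') in
theorem exists_induces : ∃ g, K.Induces K' g := by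
  have := F₂.projective
  obtain ⟨A, hA⟩ := F₁.exists_extension F₂.i
  exact ⟨K.isPushout.desc K'.c (A ≫ K'.e) (by rw [K'.isPushout.w, reassoc_of% hA]), A, hA,
    K.isPushout.inl_desc _ _ _, K.isPushout.inr_desc _ _ _⟩

variable (K) in
theorem induces_id : K.Induces K (𝟙 K.obj) :=
  ⟨𝟙 _, by simp, by simp, by simp⟩

theorem Induces.comp {g : K.obj ⟶ K'.obj} {g' : K'.obj ⟶ K''.obj} (h : K.Induces K' g)
    (h' : K'.Induces K'' g') : K.Induces K'' (g ≫ g') := by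
  obtain ⟨A, hA, hc, he⟩ := h
  obtain ⟨A', hA', hc', he'⟩ := h'
  refine ⟨A ≫ A', ?_, ?_, ?_⟩
  · rw [reassoc_of% hA, hA']
  · rw [reassoc_of% hc, hc']
  · rw [reassoc_of% he, he', Category.assoc]

end Cone

section Stable

variable {D : Type*} [Category* D] [Preadditive D] (F : C ⥤ D) [F.Additive]
  (hF : ∀ P : C, Projective P → IsZero (F.obj P))

include hF

theorem map_eq_of_sub_eq_comp {X Y P : C} (hP : Projective P) {f g : X ⟶ Y} (a : X ⟶ P)
    (b : P ⟶ Y) (h : f - g = a ≫ b) : F.map f = F.map g := by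
  rw [← sub_eq_zero, ← F.map_sub, h, F.map_comp, (hF P hP).eq_of_src (F.map b) 0, comp_zero]

theorem Induces.map_eq {f : M ⟶ M'} {σ τ : E.S ⟶ E'.S} (h : E.Induces E' f σ)
    (h' : E.Induces E' f τ) : F.map σ = F.map τ := by
  obtain ⟨A, hA, hσ⟩ := h
  obtain ⟨B, hB, hτ⟩ := h'
  obtain ⟨w, hw⟩ := E.exists_desc (A - B) (by rw [Preadditive.comp_sub, hA, hB, sub_self])
  refine map_eq_of_sub_eq_comp F hF E'.projective w E'.p (hom_ext ?_)
  rw [Preadditive.comp_sub, hσ, hτ, ← Preadditive.sub_comp, reassoc_of% hw]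

theorem Induces.isIso_map {E₁ E₂ : Cosyzygy M} {σ : E₁.S ⟶ E₂.S}
    (h : E₁.Induces E₂ (𝟙 M) σ) : IsIso (F.map σ) := by
  obtain ⟨τ, hτ⟩ := E₂.exists_induces E₁ (𝟙 M)
  have h₁ := h.comp hτ
  have h₂ := hτ.comp h
  rw [Category.comp_id] at h₁ h₂
  refine ⟨F.map τ, ?_, ?_⟩
  · rw [← F.map_comp, ← F.map_id, h₁.map_eq F hF E₁.induces_id]
  · rw [← F.map_comp, ← F.map_id, h₂.map_eq F hF E₂.induces_id]

namespace Cone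

variable {N : C} {f : M ⟶ N} {F₁ F₂ : Cosyzygy M} {K : F₁.Cone f} {K' : F₂.Cone f}

theorem Induces.map_eq {g g' : K.obj ⟶ K'.obj} (h : K.Induces K' g) (h' : K.Induces K' g') :
    F.map g = F.map g' := by
  obtain ⟨A, hA, hc, he⟩ := h
  obtain ⟨B, hB, hc', he'⟩ := h'
  obtain ⟨w, hw⟩ := F₁.exists_desc (A - B) (by rw [Preadditive.comp_sub, hA, hB, sub_self])
  refine map_eq_of_sub_eq_comp F hF F₂.projective (K.δ ≫ w) K'.e (K.isPushout.hom_ext ?_ ?_)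
  · rw [Preadditive.comp_sub, hc, hc', sub_self, Category.assoc, reassoc_of% K.c_comp_δ, zero_comp]
  · rw [Preadditive.comp_sub, he, he', ← Preadditive.sub_comp, Category.assoc,
      reassoc_of% K.e_comp_δ, reassoc_of% hw]

theorem Induces.map_δ_comp_map {g : K.obj ⟶ K'.obj} (hg : K.Induces K' g) {σ : F₁.S ⟶ F₂.S}
    (hσ : F₁.Induces F₂ (𝟙 M) σ) : F.map K.δ ≫ F.map σ = F.map g ≫ F.map K'.δ := by
  obtain ⟨A, hA, hc, he⟩ := hg
  obtain ⟨τ, hτ⟩ := F₁.exists_desc (A ≫ F₂.p) (by rw [reassoc_of% hA, F₂.zero])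
  have hτ' : F₁.Induces F₂ (𝟙 M) τ := ⟨A, by rw [hA, Category.id_comp], hτ⟩
  rw [hσ.map_eq F hF hτ', ← F.map_comp, ← F.map_comp]
  congr 1
  apply K.isPushout.hom_ext
  · rw [reassoc_of% K.c_comp_δ, zero_comp, reassoc_of% hc, K'.c_comp_δ]
  · rw [reassoc_of% K.e_comp_δ, hτ, reassoc_of% he, K'.e_comp_δ]

variable (K K') in
theorem exists_iso {σ : F₁.S ⟶ F₂.S} (hσ : F₁.Induces F₂ (𝟙 M) σ) :
    ∃ γ : F.obj K.obj ≅ F.obj K'.obj, F.map K.c ≫ γ.hom = F.map K'.c ∧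
      F.map K.δ ≫ F.map σ = γ.hom ≫ F.map K'.δ := by
  obtain ⟨g, hg⟩ := K.exists_induces K'
  obtain ⟨g', hg'⟩ := K'.exists_induces K
  refine ⟨⟨F.map g, F.map g', ?_, ?_⟩, ?_, hg.map_δ_comp_map F hF hσ⟩
  · rw [← F.map_comp, ← F.map_id, (hg.comp hg').map_eq F hF K.induces_id]
  · rw [← F.map_comp, ← F.map_id, (hg'.comp hg).map_eq F hF K'.induces_id]
  · obtain ⟨_, -, hc, -⟩ := hg
    rw [← F.map_comp, hc]

end Cone

end Stable

end Cosyzygy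

end Cosyzygy

namespace TriMod

variable {𝕜 : Type u} [Field 𝕜]

def isColimitCokerπ {M N : TriMod 𝕜} (f : M ⟶ N) :
    IsColimit (CokernelCofork.ofπ (cokerπ f) (comp_cokerπ f)) :=
  CokernelCofork.IsColimit.ofπ _ _ (fun g hg => cokerDesc f g hg) (fun g hg => cokerπ_desc f g hg)
    fun g hg m hm => by rw [← cancel_epi (cokerπ f), hm, cokerπ_desc]

instance : HasCokernels (TriMod 𝕜) where
  has_colimit f := ⟨⟨_, isColimitCokerπ f⟩⟩

instance : HasBinaryCoproducts (TriMod 𝕜) :=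
  Adjunction.hasColimitsOfShape_of_equivalence (GInf 𝕜).inv

instance : HasPushouts (TriMod 𝕜) :=
  have : HasCoequalizers (TriMod 𝕜) := Preadditive.hasCoequalizers_of_hasCokernels
  hasPushouts_of_hasBinaryCoproducts_of_hasCoequalizers _

section Cofree

variable {V : ℤ → ℤ → ℤ → Type u} [∀ i j k, AddCommGroup (V i j k)] [∀ i j k, Module 𝕜 (V i j k)]

/-- The evaluation at `1` of an element of `Hom_𝕜(Λ₃, V)`, the counit of the adjunction between
the forgetful functor to trigraded vector spaces and `V ↦ Hom_𝕜(Λ₃, V)`. -/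
def cofreeEval (i j k : ℤ) : CofreeX V i j k →ₗ[𝕜] V i j k where
  toFun x := x.e
  map_add' _ _ := rfl
  map_smul' _ _ := rfl

theorem toCofree_comp_cofreeMap_eq {M : TriMod 𝕜} {f : M ⟶ cofree 𝕜 V}
    {φ : ∀ i j k, M.X i j k →ₗ[𝕜] V i j k}
    (hφ : ∀ i j k x, φ i j k x = cofreeEval (𝕜 := 𝕜) (V := V) i j k (f.app i j k x)) :
    toCofree M ≫ cofreeMap φ = f := by
  let a i j k (x : M.X i j k) : CofreeX V i j k := f.app i j k x
  have he i j k (x : M.X i j k) : φ i j k x = (a i j k x).e := hφ i j k x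
  have h₁ {i j k} (x : M.X i j k) : a _ _ _ (M.d1 j k rfl x) =
      cofree1 (𝕜 := 𝕜) V i j k (a i j k x) := f.comm1 j k rfl x
  have h₂ {i j k} (x : M.X i j k) : a _ _ _ (M.d2 i k rfl x) =
      cofree2 (𝕜 := 𝕜) V i j k (a i j k x) := f.comm2 i k rfl x
  have h₃ {i j k} (x : M.X i j k) : a _ _ _ (M.d3 i j rfl x) =
      cofree3 (𝕜 := 𝕜) V i j k (a i j k x) := f.comm3 i j rfl x
  ext i j k x
  change cofreeMapX φ i j k (toCofreeX M i j k x) = a i j k x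
  apply CofreeX.ext <;> simp [he, h₁, h₂, h₃]

theorem exists_extension_cofree {M J : TriMod 𝕜} (i : M ⟶ J)
    (s : ∀ i j k, J.X i j k →ₗ[𝕜] M.X i j k) (hs : ∀ a b c x, s a b c (i.app a b c x) = x)
    (g : M ⟶ cofree 𝕜 V) : ∃ h, i ≫ h = g := by
  let φ a b c := cofreeEval a b c ∘ₗ g.app a b c ∘ₗ s a b c
  refine ⟨toCofree J ≫ cofreeMap φ, ?_⟩
  calc i ≫ toCofree J ≫ cofreeMap φ
      = toCofree M ≫ cofreeMap i.app ≫ cofreeMap φ := by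
        rw [← Category.assoc, toCofree_naturality, Category.assoc]
    _ = toCofree M ≫ cofreeMap fun a b c => φ a b c ∘ₗ i.app a b c := rfl
    _ = g := toCofree_comp_cofreeMap_eq fun a b c x =>
      congrArg (fun y => cofreeEval (𝕜 := 𝕜) (V := V) a b c (g.app a b c y)) (hs a b c x)

end Cofree

theorem exists_extension_projective {M J P : TriMod 𝕜} [Projective P] (i : M ⟶ J)
    (s : ∀ i j k, J.X i j k →ₗ[𝕜] M.X i j k) (hs : ∀ a b c x, s a b c (i.app a b c x) = x)
    (g : M ⟶ P) : ∃ h, i ≫ h = g := by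
  have := epi_fromCofree_unshift P
  obtain ⟨h, hh⟩ := exists_extension_cofree i s hs
    (g ≫ Projective.factorThru (𝟙 P) (fromCofree P (unshift P)))
  refine ⟨h ≫ fromCofree P (unshift P), ?_⟩
  rw [reassoc_of% hh, Projective.factorThru_comp, Category.comp_id]

/-- The cosyzygy by which the shift of the stable category `𝓢𝓜₃` is defined. -/
abbrev cofreeCosyzygy (M : TriMod 𝕜) : Cosyzygy M where
  i := toCofree M
  p := toSusp M
  zero := toCofree_toSusp M
  isColimit := isColimitCokerπ (toCofree M)
  projective := inferInstance
  exists_extension := exists_extension_projective _ cofreeEval fun _ _ _ _ => rfl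

theorem induces_suspMap {M N : TriMod 𝕜} (f : M ⟶ N) :
    (cofreeCosyzygy M).Induces (cofreeCosyzygy N) f (suspMap f) :=
  ⟨cofreeMap f.app, (toCofree_naturality f).symm, toSusp_suspMap f⟩

/-- The cone of `f` by which the distinguished triangles of `𝓢𝓜₃` are defined. -/
noncomputable def pushoutCone {M N : TriMod 𝕜} (f : M ⟶ N) :
    (cofreeCosyzygy M).Cone f where
  c := pushout.inl f (toCofree M)
  e := pushout.inr f (toCofree M)
  δ := pushout.desc 0 (toSusp M) (by rw [comp_zero, toCofree_toSusp])
  isPushout := IsPushout.of_hasPushout f (toCofree M)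
  c_comp_δ := pushout.inl_desc _ _ _
  e_comp_δ := pushout.inr_desc _ _ _

end TriMod

theorem StabMod.isZero_proj_obj {𝕜 : Type u} [Field 𝕜] (P : TriMod 𝕜) (hP : Projective P) :
    IsZero ((StabMod.proj 𝕜).obj P) := by
  rw [IsZero.iff_id_eq_zero, ← (StabMod.proj 𝕜).map_id, ← (StabMod.proj 𝕜).map_zero]
  exact CategoryTheory.Quotient.sound _ ⟨P, hP, 𝟙 P, 𝟙 P, by simp⟩

namespace GInf

variable {𝕜 : Type u} [Field 𝕜]

open CochainComplex CochainComplex.mappingCone TriMod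

theorem epi_f {X Y : CochainComplex (GrMod 𝕜) ℤ} (f : X ⟶ Y) [Epi f] (n : ℤ) : Epi (f.f n) := by
  refine GrMod.epi_of_surjective _ ?_
  rw [← LinearMap.range_eq_top, eq_top_iff, ← (Y.X n).iSup_part]
  refine iSup_le fun p y hy => ?_
  obtain ⟨x, hx⟩ := surjective_of_epi ((GInf 𝕜).map f) p.1 p.2 n ⟨y, hy⟩
  exact ⟨x.1, congrArg Subtype.val hx⟩

variable (X : CochainComplex (GrMod 𝕜) ℤ) {Y : CochainComplex (GrMod 𝕜) ℤ}

theorem projective_obj_mappingCone_id [∀ n, Projective (X.X n)] :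
    Projective ((GInf 𝕜).obj (mappingCone (𝟙 X))) := by
  refine ((GInf 𝕜).asEquivalence.map_projective_iff _).2 ⟨fun f e _ => ?_⟩
  have := epi_f e
  exact exists_lift_mappingCone_id_of_epi f e

variable {X} in
theorem exists_degreewise_retraction_map_inr (f : X ⟶ Y) :
    ∃ s : ∀ i j k, ((GInf 𝕜).obj (mappingCone f)).X i j k →ₗ[𝕜] ((GInf 𝕜).obj Y).X i j k,
      ∀ i j k x, s i j k (((GInf 𝕜).map (inr f)).app i j k x) = x :=
  ⟨fun _ _ k => ((snd f).v k k (add_zero k)).lin.restrict fun _ hm => GrMod.Hom.map_part _ hm,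
    fun _ _ k x => Subtype.ext (congrArg (fun t => GrMod.Hom.lin t x.1) (inr_f_snd_v f k))⟩

/-- The cosyzygy of `𝓖_∞(X)` given by the image of the cone of the identity of `X`. -/
noncomputable abbrev coneCosyzygy [∀ n, Projective (X.X n)] : Cosyzygy ((GInf 𝕜).obj X) where
  i := (GInf 𝕜).map (inr (𝟙 X))
  p := (GInf 𝕜).map (mappingConeδ (𝟙 X))
  zero := by rw [← Functor.map_comp, inr_comp_mappingConeδ, Functor.map_zero]
  isColimit := CokernelCofork.mapIsColimit _ (isColimitMappingConeδ (𝟙 X)) (GInf 𝕜)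
  projective := projective_obj_mappingCone_id X
  exists_extension g :=
    have ⟨s, hs⟩ := exists_degreewise_retraction_map_inr (𝟙 X)
    exists_extension_projective _ s hs g

variable {X} in
theorem induces_map_shift [∀ n, Projective (X.X n)] [∀ n, Projective (Y.X n)] (f : X ⟶ Y) :
    (coneCosyzygy X).Induces (coneCosyzygy Y) ((GInf 𝕜).map f) ((GInf 𝕜).map (f⟦(1 : ℤ)⟧')) := by
  refine ⟨(GInf 𝕜).map (mappingCone.map (𝟙 X) (𝟙 Y) f f (by simp)), ?_, ?_⟩
  · simp [coneCosyzygy, ← Functor.map_comp, mappingCone.map]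
  · simp only [coneCosyzygy, ← Functor.map_comp, map_comp_mappingConeδ]

/-- A comparison of the cosyzygies `𝓖_∞(X[1])` and `susp (𝓖_∞(X))` of `𝓖_∞(X)`. It is unique only
in the stable category. -/
noncomputable def shiftToSusp [∀ n, Projective (X.X n)] :
    (GInf 𝕜).obj (X⟦(1 : ℤ)⟧) ⟶ susp ((GInf 𝕜).obj X) :=
  ((coneCosyzygy X).exists_induces (cofreeCosyzygy _) (𝟙 _)).choose

theorem induces_shiftToSusp [∀ n, Projective (X.X n)] :
    (coneCosyzygy X).Induces (cofreeCosyzygy _) (𝟙 _) (shiftToSusp X) :=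
  ((coneCosyzygy X).exists_induces (cofreeCosyzygy _) (𝟙 _)).choose_spec

instance [∀ n, Projective (X.X n)] : IsIso ((StabMod.proj 𝕜).map (shiftToSusp X)) :=
  (induces_shiftToSusp X).isIso_map _ StabMod.isZero_proj_obj

variable {X} in
theorem shiftToSusp_naturality [∀ n, Projective (X.X n)] [∀ n, Projective (Y.X n)] (f : X ⟶ Y) :
    (StabMod.proj 𝕜).map ((GInf 𝕜).map (f⟦(1 : ℤ)⟧') ≫ shiftToSusp Y) =
      (StabMod.proj 𝕜).map (shiftToSusp X ≫ suspMap ((GInf 𝕜).map f)) := by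
  have h := (induces_map_shift f).comp (induces_shiftToSusp Y)
  rw [Category.comp_id, ← Category.id_comp ((GInf 𝕜).map f)] at h
  exact h.map_eq _ StabMod.isZero_proj_obj ((induces_shiftToSusp X).comp (induces_suspMap _))

variable {X}

/-- The image of the mapping cone of `f`, as a cone formed with `coneCosyzygy X`. -/
noncomputable def mappingConeCone [∀ n, Projective (X.X n)] (f : X ⟶ Y) :
    (coneCosyzygy X).Cone ((GInf 𝕜).map f) where
  c := (GInf 𝕜).map (inr f)
  e := (GInf 𝕜).map (mappingCone.map (𝟙 X) f (𝟙 X) f (by simp))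
  δ := (GInf 𝕜).map (mappingConeδ f)
  isPushout := (isPushout_mappingConeMap f).map (GInf 𝕜)
  c_comp_δ := by rw [← Functor.map_comp, inr_comp_mappingConeδ, Functor.map_zero]
  e_comp_δ := by
    rw [← Functor.map_comp, map_comp_mappingConeδ, CategoryTheory.Functor.map_id, Category.comp_id]

theorem isDistinguished_mappingCone [∀ n, Projective (X.X n)] (f : X ⟶ Y) :
    StabMod.IsDistinguished ((GInf 𝕜 ⋙ StabMod.proj 𝕜).map f)
      ((GInf 𝕜 ⋙ StabMod.proj 𝕜).map (inr f))
      ((GInf 𝕜 ⋙ StabMod.proj 𝕜).map (mappingConeδ f) ≫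
        (StabMod.proj 𝕜).map (shiftToSusp X)) := by
  let K := pushoutCone ((GInf 𝕜).map f)
  obtain ⟨γ, hc, hδ⟩ := Cosyzygy.Cone.exists_iso (StabMod.proj 𝕜) StabMod.isZero_proj_obj
    (mappingConeCone f) K (induces_shiftToSusp X)
  refine ⟨_, _, K.obj, _, K.c, K.e, K.δ, Iso.refl _, Iso.refl _, γ, K.isPushout, K.c_comp_δ,
    K.e_comp_δ, ?_, ?_, ?_⟩
  · exact (Category.comp_id _).trans (Category.id_comp _).symm
  · exact hc.trans (Category.id_comp _).symm
  · exact (congrArg (_ ≫ ·) ((StabMod.shift 𝕜).map_id _)).trans ((Category.comp_id _).trans hδ)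

end GInf

theorem StabMod.IsDistinguished.of_iso {𝕜 : Type u} [Field 𝕜] {X Y Z X' Y' Z' : StabMod 𝕜}
    {u : X ⟶ Y} {v : Y ⟶ Z} {w : Z ⟶ (shift 𝕜).obj X} (h : IsDistinguished u v w)
    {u' : X' ⟶ Y'} {v' : Y' ⟶ Z'} {w' : Z' ⟶ (shift 𝕜).obj X'}
    (α : X' ≅ X) (β : Y' ≅ Y) (γ : Z' ≅ Z)
    (hu : u' ≫ β.hom = α.hom ≫ u) (hv : v' ≫ γ.hom = β.hom ≫ v)
    (hw : w' ≫ (shift 𝕜).map α.hom = γ.hom ≫ w) : IsDistinguished u' v' w' := by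
  obtain ⟨M, N, C, f, c, e, δ, α', β', γ', hP, hc, he, h₁, h₂, h₃⟩ := h
  refine ⟨M, N, C, f, c, e, δ, α ≪≫ α', β ≪≫ β', γ ≪≫ γ', hP, hc, he, ?_, ?_, ?_⟩
  · simp only [Iso.trans_hom, Category.assoc, reassoc_of% hu, h₁]
  · simp only [Iso.trans_hom, Category.assoc, reassoc_of% hv, h₂]
  · rw [Iso.trans_hom, Iso.trans_hom, Functor.map_comp, reassoc_of% hw, h₃, Category.assoc]
    rfl

namespace GInf

variable (𝕜 : Type u) [Field 𝕜]

open CochainComplex.mappingCone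

/-- The inclusion of the complexes of graded projective modules into the graded dg modules. -/
noncomputable abbrev inclProj :
    CochainComplex (GrMod.Proj 𝕜) ℤ ⥤ CochainComplex (GrMod 𝕜) ℤ :=
  (isProjective (GrMod 𝕜)).ι.mapHomologicalComplex (ComplexShape.up ℤ)

instance (K : CochainComplex (GrMod.Proj 𝕜) ℤ) (n : ℤ) :
    Projective (((inclProj 𝕜).obj K).X n) :=
  (K.X n).property

variable {𝕜} in
theorem map_eq_of_homotopy {K L : CochainComplex (GrMod.Proj 𝕜) ℤ} {f g : K ⟶ L}
    (h : Homotopy f g) : (inclProj 𝕜 ⋙ GInf 𝕜 ⋙ StabMod.proj 𝕜).map f =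
      (inclProj 𝕜 ⋙ GInf 𝕜 ⋙ StabMod.proj 𝕜).map g := by
  obtain ⟨w, hw⟩ := exists_sub_eq_inr_comp_of_homotopy
    ((isProjective (GrMod 𝕜)).ι.mapHomotopy h)
  refine Cosyzygy.map_eq_of_sub_eq_comp (StabMod.proj 𝕜) StabMod.isZero_proj_obj
    (projective_obj_mappingCone_id _) ((GInf 𝕜).map (inr (𝟙 ((inclProj 𝕜).obj K))))
    ((GInf 𝕜).map w) ?_
  rw [← Functor.map_comp, ← hw, Functor.map_sub]

/-- The functor `𝓖`. -/
noncomputable def stable :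
    HomotopyCategory (GrMod.Proj 𝕜) (ComplexShape.up ℤ) ⥤ StabMod 𝕜 :=
  CategoryTheory.Quotient.lift _ (inclProj 𝕜 ⋙ GInf 𝕜 ⋙ StabMod.proj 𝕜)
    fun _ _ _ _ ⟨h⟩ => map_eq_of_homotopy h

theorem quotient_comp_stable :
    HomotopyCategory.quotient (GrMod.Proj 𝕜) (ComplexShape.up ℤ) ⋙ stable 𝕜 =
      inclProj 𝕜 ⋙ GInf 𝕜 ⋙ StabMod.proj 𝕜 :=
  CategoryTheory.Quotient.lift_spec _ _ _

instance : (stable 𝕜).Additive := by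
  have : (HomotopyCategory.quotient (GrMod.Proj 𝕜) (ComplexShape.up ℤ) ⋙ stable 𝕜).Additive := by
    rw [quotient_comp_stable]
    infer_instance
  exact Functor.additive_of_full_essSurj_comp
    (HomotopyCategory.quotient (GrMod.Proj 𝕜) (ComplexShape.up ℤ)) _

/-- The comparison of `𝓖_∞(M[1])` with `susp (𝓖_∞(M))` in the stable category, natural in the
complex `M` of graded projective modules. -/
noncomputable def shiftIso :
    shiftFunctor (CochainComplex (GrMod.Proj 𝕜) ℤ) (1 : ℤ) ⋙
      inclProj 𝕜 ⋙ GInf 𝕜 ⋙ StabMod.proj 𝕜 ≅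
        (inclProj 𝕜 ⋙ GInf 𝕜 ⋙ StabMod.proj 𝕜) ⋙ StabMod.shift 𝕜 :=
  Functor.isoWhiskerRight ((inclProj 𝕜).commShiftIso (1 : ℤ)) (GInf 𝕜 ⋙ StabMod.proj 𝕜) ≪≫
    NatIso.ofComponents
      (F := inclProj 𝕜 ⋙ shiftFunctor _ (1 : ℤ) ⋙ GInf 𝕜 ⋙ StabMod.proj 𝕜)
      (G := (inclProj 𝕜 ⋙ GInf 𝕜 ⋙ StabMod.proj 𝕜) ⋙ StabMod.shift 𝕜)
      (fun K => (asIso ((StabMod.proj 𝕜).map (shiftToSusp ((inclProj 𝕜).obj K))) :))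
      fun f => shiftToSusp_naturality ((inclProj 𝕜).map f)

/-- The isomorphism `𝓖(M[1]) ≅ 𝓖(M)[1]`. -/
noncomputable def stableShiftIso :
    shiftFunctor (HomotopyCategory (GrMod.Proj 𝕜) (ComplexShape.up ℤ)) (1 : ℤ) ⋙ stable 𝕜 ≅
      stable 𝕜 ⋙ StabMod.shift 𝕜 :=
  CategoryTheory.Quotient.natIsoLift _
    (Functor.isoWhiskerRight ((HomotopyCategory.quotient (GrMod.Proj 𝕜)
      (ComplexShape.up ℤ)).commShiftIso (1 : ℤ)).symm (stable 𝕜) ≪≫ shiftIso 𝕜)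

theorem stableShiftIso_hom_app (K : CochainComplex (GrMod.Proj 𝕜) ℤ) :
    (stableShiftIso 𝕜).hom.app ((HomotopyCategory.quotient _ _).obj K) =
      (stable 𝕜).map (((HomotopyCategory.quotient (GrMod.Proj 𝕜)
        (ComplexShape.up ℤ)).commShiftIso (1 : ℤ)).inv.app K) ≫ (shiftIso 𝕜).hom.app K := rfl

theorem map_commShiftIso_hom_app_comp_stableShiftIso (K : CochainComplex (GrMod.Proj 𝕜) ℤ) :
    (stable 𝕜).map (((HomotopyCategory.quotient (GrMod.Proj 𝕜)
      (ComplexShape.up ℤ)).commShiftIso (1 : ℤ)).hom.app K) ≫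
        (stableShiftIso 𝕜).hom.app ((HomotopyCategory.quotient _ _).obj K) =
      (shiftIso 𝕜).hom.app K := by
  rw [stableShiftIso_hom_app]
  refine ((stable 𝕜).map_comp_assoc _ _ _).symm.trans ?_
  rw [Iso.hom_inv_id_app, CategoryTheory.Functor.map_id]
  exact Category.id_comp _

variable {𝕜}

theorem map_mappingConeδ_comp_shiftIso {K L : CochainComplex (GrMod.Proj 𝕜) ℤ} (f : K ⟶ L) :
    (inclProj 𝕜 ⋙ GInf 𝕜 ⋙ StabMod.proj 𝕜).map (mappingConeδ f) ≫ (shiftIso 𝕜).hom.app K =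
      (GInf 𝕜 ⋙ StabMod.proj 𝕜).map (mapHomologicalComplexIso f (isProjective (GrMod 𝕜)).ι).hom ≫
        (GInf 𝕜 ⋙ StabMod.proj 𝕜).map (mappingConeδ ((inclProj 𝕜).map f)) ≫
          (StabMod.proj 𝕜).map (shiftToSusp ((inclProj 𝕜).obj K)) := by
  refine ((GInf 𝕜 ⋙ StabMod.proj 𝕜).map_comp_assoc _ _ _).symm.trans (Eq.trans ?_
    ((GInf 𝕜 ⋙ StabMod.proj 𝕜).map_comp_assoc _ _ _))
  exact congrArg (fun g => (GInf 𝕜 ⋙ StabMod.proj 𝕜).map g ≫ _) (map_δ f _)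

theorem isDistinguished_triangleh {K L : CochainComplex (GrMod.Proj 𝕜) ℤ} (f : K ⟶ L) :
    StabMod.IsDistinguished ((stable 𝕜).map (triangleh f).mor₁) ((stable 𝕜).map (triangleh f).mor₂)
      ((stable 𝕜).map (triangleh f).mor₃ ≫ (stableShiftIso 𝕜).hom.app (triangleh f).obj₁) := by
  have hδ : (stable 𝕜).map (triangleh f).mor₃ ≫
      (stableShiftIso 𝕜).hom.app ((HomotopyCategory.quotient _ _).obj K) =
        (inclProj 𝕜 ⋙ GInf 𝕜 ⋙ StabMod.proj 𝕜).map (mappingConeδ f) ≫ (shiftIso 𝕜).hom.app K := by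
    rw [← map_commShiftIso_hom_app_comp_stableShiftIso]
    exact (stable 𝕜).map_comp_assoc _ _ _
  refine (isDistinguished_mappingCone ((inclProj 𝕜).map f)).of_iso (Iso.refl _) (Iso.refl _)
    ((GInf 𝕜 ⋙ StabMod.proj 𝕜).mapIso (mapHomologicalComplexIso f _)) ?_ ?_ ?_
  · exact (Category.comp_id _).trans (Category.id_comp _).symm
  · refine Eq.trans ?_ (Category.id_comp _).symm
    exact ((GInf 𝕜 ⋙ StabMod.proj 𝕜).map_comp _ _).symm.trans (congrArg _ (map_inr f _))
  · refine (congrArg (_ ≫ ·) ((StabMod.shift 𝕜).map_id _)).trans ((Category.comp_id _).trans ?_)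
    exact hδ.trans (map_mappingConeδ_comp_shiftIso f)

theorem isDistinguished_of_mem
    (T : Pretriangulated.Triangle (HomotopyCategory (GrMod.Proj 𝕜) (ComplexShape.up ℤ)))
    (hT : T ∈ Pretriangulated.distinguishedTriangles) :
    StabMod.IsDistinguished ((stable 𝕜).map T.mor₁) ((stable 𝕜).map T.mor₂)
      ((stable 𝕜).map T.mor₃ ≫ (stableShiftIso 𝕜).hom.app T.obj₁) := by
  obtain ⟨K, L, f, ⟨e⟩⟩ := hT
  refine (isDistinguished_triangleh f).of_iso
    ((stable 𝕜).mapIso (Pretriangulated.Triangle.π₁.mapIso e))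
    ((stable 𝕜).mapIso (Pretriangulated.Triangle.π₂.mapIso e))
    ((stable 𝕜).mapIso (Pretriangulated.Triangle.π₃.mapIso e)) ?_ ?_ ?_
  · exact ((stable 𝕜).map_comp _ _).symm.trans
      ((congrArg (stable 𝕜).map e.hom.comm₁).trans ((stable 𝕜).map_comp _ _))
  · exact ((stable 𝕜).map_comp _ _).symm.trans
      ((congrArg (stable 𝕜).map e.hom.comm₂).trans ((stable 𝕜).map_comp _ _))
  · calc ((stable 𝕜).map T.mor₃ ≫ (stableShiftIso 𝕜).hom.app T.obj₁) ≫
          (StabMod.shift 𝕜).map ((stable 𝕜).map e.hom.hom₁)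
        = (stable 𝕜).map (T.mor₃ ≫ e.hom.hom₁⟦(1 : ℤ)⟧') ≫
            (stableShiftIso 𝕜).hom.app (triangleh f).obj₁ := by
          rw [Category.assoc, Functor.map_comp, Category.assoc]
          exact congrArg (_ ≫ ·) ((stableShiftIso 𝕜).hom.naturality e.hom.hom₁).symm
      _ = _ := by rw [e.hom.comm₃, Functor.map_comp, Category.assoc]; rfl

end GInf

/-- The functor `𝓖_∞` from graded dg modules over `(A,d)` to `𝓜₃` is an equivalence, and it descends to
a functor `G` from the homotopy category of complexes of graded projective `A`-modules to `𝓢𝓜₃`,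
which is exact: it is additive, it commutes with the shifts up to a natural isomorphism `φ`,
and, through `φ`, it takes distinguished triangles to distinguished triangles. -/
theorem mainTheorem8 (𝕜 : Type u) [Field 𝕜] :
    (GInf 𝕜).IsEquivalence ∧
    ∃ G : HomotopyCategory (GrMod.Proj 𝕜) (ComplexShape.up ℤ) ⥤ StabMod 𝕜,
      HomotopyCategory.quotient (GrMod.Proj 𝕜) (ComplexShape.up ℤ) ⋙ G =
        (isProjective (GrMod 𝕜)).ι.mapHomologicalComplex (ComplexShape.up ℤ) ⋙ GInf 𝕜 ⋙
          StabMod.proj 𝕜 ∧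
      G.Additive ∧
      ∃ φ : shiftFunctor (HomotopyCategory (GrMod.Proj 𝕜) (ComplexShape.up ℤ)) (1 : ℤ) ⋙ G ≅
          G ⋙ StabMod.shift 𝕜,
        ∀ T ∈ Pretriangulated.distinguishedTriangles
            (C := HomotopyCategory (GrMod.Proj 𝕜) (ComplexShape.up ℤ)),
          StabMod.IsDistinguished (G.map T.mor₁) (G.map T.mor₂)
            (G.map T.mor₃ ≫ φ.hom.app T.obj₁) :=
  ⟨inferInstance, GInf.stable 𝕜, GInf.quotient_comp_stable 𝕜, inferInstance,
    GInf.stableShiftIso 𝕜, GInf.isDistinguished_of_mem⟩
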